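/- Let $R$ be a unique factorization domain with group of units $R^*$ and field of fractions $K$, and fix a set $\mathcal U\subset R\setminus\{0\}$ containing exactly one associate of every nonzero element of $R$. Let $\mathrm{GA}_2(R)$ be the group of $R$-algebra automorphisms of $R[x,y]$ (the product is composition), and let $\mathcal B^1(R)=\{px+Q(y)\;:\;p\in R\setminus\{0\},\ Q\in R[y]\}$. For a commutative ring $A$, let $\mathrm{VA}_1(A)$ be the set of images of $y$ under the $A$-algebra automorphisms of $A[y]$. An automorphism of $R[x,y]$ is tame if it lies in the subgroup of $\mathrm{GA}_2(R)$ generated by the affine automorphisms (those $\sigma$ for which $\sigma(x)$ and $\sigma(y)$ have degree $1$) and the triangular ones (those $\sigma$ with $\sigma(x)\in R^*x+R[y]$ and $\sigma(y)\in R^*y+R$). Let $(p_1,p_2,Q_1,Q_2)$ be a reduced quadruplet, that is: $p_1\in\mathcal U$, $p_2\in K\setminus\{0\}$, $Q_1\in R[y]$, $Q_2\in K[y]$, $\deg Q_1\ge 1$, $\deg Q_2\ge 2$, $Q_1(0)=Q_2(0)=0$, $\gcd(p_1,Q_1)=1$ in $R[y]$, and $$F=p_2y+Q_2(p_1x+Q_1(y))\in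 R[x,y].$$ Assume that $F$ is a coordinate, i.e. $F=\sigma(y)$ for some $\sigma\in\mathrm{GA}_2(R)$. We say that $F$ is tame if $F=\sigma(y)$ for some tame automorphism $\sigma$; that $F$ has a mate of length $1$ if there are $G\in\mathcal B^1(R)$ and $\sigma\in\mathrm{GA}_2(R)$ with $\sigma(x)=F$ and $\sigma(y)=G$; and that $F$ has length "$1+1$" if there are $\sigma,\tau\in\mathrm{GA}_2(R)$ with $\sigma(y),\tau(y)\in\mathcal B^1(R)$ and $\sigma\tau(y)=F$. Then: 1. $F$ is tame if and only if there are $\sigma,\tau\in\mathrm{GA}_2(R)$ such that $\sigma(x),\sigma(y),\tau(x),\tau(y)\in\mathcal B^1(R)$ and $\sigma\tau(y)=F$. 2. $F$ has a mate of length $1$ if and only if $p_1p_2\in R^*$. 3. $F$ has length "$1+1$" if and only if the reduction of $Q_1$ modulo $p_1$ lies in $\mathrm{VA}_1(R/p_1R)$. 4. If $F$ is tame or $F$ has a mate of length $1$, then $F$ has length "$1+1$". -/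

import Mathlib

open Polynomial

noncomputable section

namespace LengthTwo

/-- `GA_n(R)`: the group of automorphisms of the `R`-algebra `R[x_1, …, x_n]`. The product is
composition, `(σ * τ) f = σ (τ f)`. For `n = 2` we write `x = X 0` and `y = X 1`. -/
abbrev GA (n : ℕ) (R : Type*) [CommRing R] : Type _ :=
  MvPolynomial (Fin n) R ≃ₐ[R] MvPolynomial (Fin n) R

/-- `VA_1(R)`: the coordinates of `R[y]`. -/
def VA₁ (R : Type*) [CommRing R] : Set R[X] :=
  {P | ∃ σ : R[X] ≃ₐ[R] R[X], σ X = P}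

/-- `VA_2(R)`: the coordinates of `R[x, y]`. -/
def VA₂ (R : Type*) [CommRing R] : Set (MvPolynomial (Fin 2) R) :=
  {F | ∃ σ : GA 2 R, σ (MvPolynomial.X 1) = F}

/-- Affine automorphisms: every component has total degree `1`. -/
def Aff (n : ℕ) (R : Type*) [CommRing R] : Set (GA n R) :=
  {σ | ∀ i, (σ (MvPolynomial.X i)).totalDegree = 1}

/-- Triangular automorphisms: `σ(x_i) ∈ R^* x_i + R[x_{i+1}, …, x_n]` for every `i`. -/
def BA (n : ℕ) (R : Type*) [CommRing R] : Set (GA n R) :=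
  {σ | ∀ i, ∃ u : Rˣ, ∃ g ∈ MvPolynomial.supported R {j : Fin n | i < j},
    σ (MvPolynomial.X i) = MvPolynomial.C (u : R) * MvPolynomial.X i + g}

/-- The tame automorphism group, generated by affine and triangular automorphisms. -/
def TA (n : ℕ) (R : Type*) [CommRing R] : Subgroup (GA n R) :=
  Subgroup.closure (Aff n R ∪ BA n R)

/-- `B^1(R)`: the polynomials `p x + Q(y)` with `p` a non zero-divisor of `R` and `Q ∈ R[y]`. -/
def B1 (R : Type*) [CommRing R] : Set (MvPolynomial (Fin 2) R) :=
  {F | ∃ p ∈ nonZeroDivisors R, ∃ Q : R[X],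
    F = MvPolynomial.C p * MvPolynomial.X 0 + aeval (MvPolynomial.X 1) Q}

/-- The polynomial `p₂ y + Q₂(p₁ x + Q₁(y))`. -/
def length2Poly {K : Type*} [CommRing K] (p₁ p₂ : K) (Q₁ Q₂ : K[X]) : MvPolynomial (Fin 2) K :=
  MvPolynomial.C p₂ * MvPolynomial.X 1 +
    aeval (MvPolynomial.C p₁ * MvPolynomial.X 0 + aeval (MvPolynomial.X 1) Q₁) Q₂

/-- `U` is a system of representatives of the non zero-divisors of `R` up to units. -/
structure IsUnitRepresentatives {R : Type*} [CommRing R] (U : Set R) : Prop where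
  subset : U ⊆ (nonZeroDivisors R : Set R)
  existsUnique : ∀ r ∈ nonZeroDivisors R, ∃! w, w ∈ U ∧ Associated r w

/-- The set `L_2(R)` of quadruplets over the field of fractions `K` of `R`. -/
structure IsL2 (R : Type*) {K : Type*} [CommRing R] [Field K] [Algebra R K]
    (p₁ p₂ : K) (Q₁ Q₂ : K[X]) : Prop where
  p₁_ne_zero : p₁ ≠ 0
  p₂_ne_zero : p₂ ≠ 0
  one_le_degree : 1 ≤ Q₁.natDegree
  two_le_degree : 2 ≤ Q₂.natDegree
  integral : ∃ F : MvPolynomial (Fin 2) R,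
    MvPolynomial.map (algebraMap R K) F = length2Poly p₁ p₂ Q₁ Q₂

/-- Reduced quadruplets of `L_2(R)`. As a reduced quadruplet has `p₁ ∈ U ⊆ R` and `Q₁ ∈ R[y]`,
these two entries are given in `R` and `R[y]`. -/
structure IsReducedL2 {R K : Type*} [CommRing R] [Field K] [Algebra R K] (U : Set R)
    (p₁ : R) (p₂ : K) (Q₁ : R[X]) (Q₂ : K[X]) : Prop where
  isL2 : IsL2 R (algebraMap R K p₁) p₂ (Q₁.map (algebraMap R K)) Q₂
  Q₁_zero : Q₁.eval 0 = 0
  Q₂_zero : Q₂.eval 0 = 0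
  p₁_mem : p₁ ∈ U
  gcd_eq_one : IsRelPrime (C p₁) Q₁

/-- `F` is tame: `F = σ(y)` for a tame automorphism `σ` of `R[x, y]`. -/
def IsTame {R : Type*} [CommRing R] (F : MvPolynomial (Fin 2) R) : Prop :=
  ∃ σ ∈ TA 2 R, σ (MvPolynomial.X 1) = F

/-- `F` has a mate of length 1: `(F, G) ∈ GA_2(R)` for some `G ∈ B^1(R)`. -/
def HasMateOfLengthOne {R : Type*} [CommRing R] (F : MvPolynomial (Fin 2) R) : Prop :=
  ∃ G ∈ B1 R, ∃ σ : GA 2 R, σ (MvPolynomial.X 0) = F ∧ σ (MvPolynomial.X 1) = G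

/-- `F` has length "1+1". -/
def HasLengthOnePlusOne {R : Type*} [CommRing R] (F : MvPolynomial (Fin 2) R) : Prop :=
  ∃ σ τ : GA 2 R, σ (MvPolynomial.X 1) ∈ B1 R ∧ τ (MvPolynomial.X 1) ∈ B1 R ∧
    (σ * τ) (MvPolynomial.X 1) = F

end LengthTwo

end

open LengthTwo

/-!
Write `f = p₁ x + Q₁(y)`. Over the fraction field, `(f, F)` is an automorphism, and two
automorphisms with the same second component differ by a triangular one. Hence if `(G, F)` is an
automorphism over the fraction field, where `G` is a coordinate over `R` of length one or of degree
less than `deg F`, then `G = c f + s`, and `gcd(p₁, Q₁) = 1` and `Q₁(0) = 0` force `c` to be a unit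
of `R`. So such a `G` forces `f` to be a coordinate over `R`, and comparing Jacobians gives the
criterion for a mate of length one. Conversely, `F = p₂ y + Q₂(f)` has length one relative to `f` as
soon as `f` is a coordinate, which by reduction modulo `p₁` is a condition on `Q₁ mod p₁`. For a
tame `F`, degree reduction along a factorization into affine and triangular automorphisms
supplies such a `G` that is itself tame, so that `f` is a tame coordinate.
-/

noncomputable section

namespace LengthTwo

local notation "𝐱" => MvPolynomial.X (0 : Fin 2)
local notation "𝐲" => MvPolynomial.X (1 : Fin 2)

/-! ### Polynomials of length one and automorphisms -/

section Basic

variable {R S : Type*} [CommRing R] [CommRing S] {n : ℕ}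

/-- The polynomial `p x + Q(y)`; over a domain, `B1` consists of those with `p ≠ 0`. -/
def length1Poly (p : R) (Q : R[X]) : MvPolynomial (Fin 2) R :=
  MvPolynomial.C p * 𝐱 + aeval 𝐲 Q

lemma mem_B1_iff [IsDomain R] {F : MvPolynomial (Fin 2) R} :
    F ∈ B1 R ↔ ∃ p Q, p ≠ 0 ∧ F = length1Poly p Q := by
  simp only [B1, mem_nonZeroDivisors_iff_ne_zero, Set.mem_ofPred_eq, length1Poly]
  exact exists_congr fun p => exists_and_left.symm

lemma length1Poly_mem_B1 [IsDomain R] {p : R} (hp : p ≠ 0) (Q : R[X]) : length1Poly p Q ∈ B1 R :=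
  mem_B1_iff.2 ⟨p, Q, hp, rfl⟩

lemma C_mul_length1Poly_add_C (c p w : R) (Q : R[X]) :
    MvPolynomial.C c * length1Poly p Q + MvPolynomial.C w =
      length1Poly (c * p) (C c * Q + C w) := by
  simp only [length1Poly, map_mul, map_add, aeval_C, MvPolynomial.algebraMap_eq]
  ring

lemma apply_C {A G : Type*} [CommRing A] [Algebra R A]
    [FunLike G (MvPolynomial (Fin n) R) A] [AlgHomClass G R (MvPolynomial (Fin n) R) A]
    (φ : G) (r : R) : φ (MvPolynomial.C r) = algebraMap R A r := by
  rw [← MvPolynomial.algebraMap_eq, AlgHomClass.commutes]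

lemma apply_length1Poly {A G : Type*} [CommRing A] [Algebra R A]
    [FunLike G (MvPolynomial (Fin 2) R) A] [AlgHomClass G R (MvPolynomial (Fin 2) R) A]
    (φ : G) (p : R) (Q : R[X]) :
    φ (length1Poly p Q) = algebraMap R A p * φ 𝐱 + aeval (φ 𝐲) Q := by
  rw [length1Poly, map_add, map_mul, aeval_algHom_apply, apply_C]

lemma map_aeval (φ : R →+* S) (P : MvPolynomial (Fin n) R) (Q : R[X]) :
    MvPolynomial.map φ (aeval P Q) = aeval (MvPolynomial.map φ P) (Q.map φ) :=
  map_aeval_eq_aeval_map (by ext; simp [MvPolynomial.algebraMap_eq]) Q P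

lemma map_length1Poly (φ : R →+* S) (p : R) (Q : R[X]) :
    MvPolynomial.map φ (length1Poly p Q) = length1Poly (φ p) (Q.map φ) := by
  simp [length1Poly, map_aeval]

/-- Restriction of bivariate polynomials to the parametrized curve `t ↦ (a(t), b(t))`. -/
def restrictCurve (a b : R[X]) : MvPolynomial (Fin 2) R →ₐ[R] R[X] :=
  MvPolynomial.aeval ![a, b]

@[simp] lemma restrictCurve_x (a b : R[X]) : restrictCurve a b 𝐱 = a := by
  simp [restrictCurve]

@[simp] lemma restrictCurve_y (a b : R[X]) : restrictCurve a b 𝐲 = b := by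
  simp [restrictCurve]

@[simp] lemma restrictCurve_C (a b : R[X]) (r : R) :
    restrictCurve a b (MvPolynomial.C r) = C r :=
  apply_C _ r

lemma restrictCurve_aeval (a b : R[X]) (P : MvPolynomial (Fin 2) R) (Q : R[X]) :
    restrictCurve a b (aeval P Q) = Q.comp (restrictCurve a b P) := by
  rw [← aeval_algHom_apply, comp_eq_aeval]

lemma restrictCurve_length1Poly (a b : R[X]) (p : R) (Q : R[X]) :
    restrictCurve a b (length1Poly p Q) = C p * a + Q.comp b := by
  simp [length1Poly, restrictCurve_aeval]

lemma restrictCurve_map (φ : R →+* S) (a b : R[X]) (P : MvPolynomial (Fin 2) R) :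
    restrictCurve (a.map φ) (b.map φ) (MvPolynomial.map φ P) = (restrictCurve a b P).map φ := by
  induction P using MvPolynomial.induction_on with
  | C r => simp
  | add p q hp hq => simp [hp, hq]
  | mul_X p i hp => fin_cases i <;> simp [hp]

lemma exists_eq_length1Poly_of_map {φ : R →+* S} (hφ : Function.Injective φ)
    {G : MvPolynomial (Fin 2) R} {p : S} {Q : S[X]}
    (h : MvPolynomial.map φ G = length1Poly p Q) :
    ∃ p' Q', G = length1Poly p' Q' ∧ φ p' = p ∧ Q'.map φ = Q := by
  have hQ : (restrictCurve 0 X G).map φ = Q := by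
    rw [← restrictCurve_map, h, restrictCurve_length1Poly]; simp
  have hp : φ ((restrictCurve X 0 G).coeff 1) = p := by
    rw [← coeff_map, ← restrictCurve_map, h, restrictCurve_length1Poly]; simp
  refine ⟨_, _, MvPolynomial.map_injective φ hφ ?_, hp, hQ⟩
  rw [map_length1Poly, hp, hQ, h]

@[simp]
lemma GA_apply_C (σ : GA n R) (r : R) : σ (MvPolynomial.C r) = MvPolynomial.C r :=
  apply_C σ r

@[simp]
lemma GA_inv_apply_self (σ : GA n R) (P : MvPolynomial (Fin n) R) : σ⁻¹ (σ P) = P :=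
  σ.symm_apply_apply P

@[simp]
lemma GA_apply_inv_self (σ : GA n R) (P : MvPolynomial (Fin n) R) : σ (σ⁻¹ P) = P :=
  σ.apply_symm_apply P

lemma GA_aeval (σ : GA n R) (P : MvPolynomial (Fin n) R) (Q : R[X]) :
    σ (aeval P Q) = aeval (σ P) Q :=
  (aeval_algHom_apply σ P Q).symm

lemma GA_length1Poly (σ : GA 2 R) (p : R) (Q : R[X]) :
    σ (length1Poly p Q) = MvPolynomial.C p * σ 𝐱 + aeval (σ 𝐲) Q :=
  apply_length1Poly σ p Q

lemma GA_ext {σ τ : GA n R} (h : ∀ i, σ (MvPolynomial.X i) = τ (MvPolynomial.X i)) : σ = τ :=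
  AlgEquiv.coe_toAlgHom_injective (MvPolynomial.algHom_ext h)

lemma GA_ext_two {σ τ : GA 2 R} (hx : σ 𝐱 = τ 𝐱) (hy : σ 𝐲 = τ 𝐲) : σ = τ :=
  GA_ext (Fin.forall_fin_two.2 ⟨hx, hy⟩)

/-- The automorphism `x_i ↦ v_i` given by a polynomial map `v` with inverse `w`. -/
def mkGA (v w : Fin n → MvPolynomial (Fin n) R)
    (hvw : ∀ i, MvPolynomial.aeval v (w i) = MvPolynomial.X i)
    (hwv : ∀ i, MvPolynomial.aeval w (v i) = MvPolynomial.X i) : GA n R :=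
  AlgEquiv.ofAlgHom (MvPolynomial.aeval v) (MvPolynomial.aeval w)
    (MvPolynomial.algHom_ext fun i => by
      rw [AlgHom.comp_apply, MvPolynomial.aeval_X, hvw, AlgHom.id_apply])
    (MvPolynomial.algHom_ext fun i => by
      rw [AlgHom.comp_apply, MvPolynomial.aeval_X, hwv, AlgHom.id_apply])

@[simp]
lemma mkGA_X (v w : Fin n → MvPolynomial (Fin n) R) (hvw hwv) (i : Fin n) :
    mkGA v w hvw hwv (MvPolynomial.X i) = v i := by
  simp [mkGA]

lemma aeval_GA_X (σ : GA n R) (P : MvPolynomial (Fin n) R) :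
    MvPolynomial.aeval (fun i => σ (MvPolynomial.X i)) P = σ P :=
  (DFunLike.congr_fun (MvPolynomial.aeval_unique σ.toAlgHom) P).symm

lemma aeval_map_GA_X (φ : R →+* S) (σ : GA n R) (P : MvPolynomial (Fin n) R) :
    MvPolynomial.aeval (fun i => MvPolynomial.map φ (σ (MvPolynomial.X i)))
      (MvPolynomial.map φ P) = MvPolynomial.map φ (σ P) := by
  rw [← aeval_GA_X σ P, MvPolynomial.aeval_eq_bind₁, MvPolynomial.aeval_eq_bind₁,
    MvPolynomial.map_bind₁]

/-- Change of coefficients for automorphisms. -/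
def baseChange (φ : R →+* S) (σ : GA n R) : GA n S :=
  mkGA (fun i => MvPolynomial.map φ (σ (MvPolynomial.X i)))
    (fun i => MvPolynomial.map φ (σ⁻¹ (MvPolynomial.X i)))
    (fun i => by rw [aeval_map_GA_X, GA_apply_inv_self, MvPolynomial.map_X])
    (fun i => by rw [aeval_map_GA_X, GA_inv_apply_self, MvPolynomial.map_X])

lemma baseChange_map (φ : R →+* S) (σ : GA n R) (P : MvPolynomial (Fin n) R) :
    baseChange φ σ (MvPolynomial.map φ P) = MvPolynomial.map φ (σ P) := by
  rw [← aeval_GA_X (baseChange φ σ), ← aeval_map_GA_X]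
  simp [baseChange]

lemma baseChange_X (φ : R →+* S) (σ : GA n R) (i : Fin n) :
    baseChange φ σ (MvPolynomial.X i) = MvPolynomial.map φ (σ (MvPolynomial.X i)) :=
  mkGA_X _ _ _ _ i

lemma C_unit_mul_C_inv (u : Rˣ) :
    MvPolynomial.C (σ := Fin n) (u : R) * MvPolynomial.C ((u⁻¹ : Rˣ) : R) = 1 := by
  rw [← map_mul, Units.mul_inv, map_one]

/-- The triangular automorphism `x ↦ u x + g(y)`, `y ↦ y`. -/
def tri (u : Rˣ) (g : R[X]) : GA 2 R :=
  mkGA ![length1Poly u g, 𝐲] ![MvPolynomial.C ((u⁻¹ : Rˣ) : R) * (𝐱 - aeval 𝐲 g), 𝐲]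
    (Fin.forall_fin_two.2 ⟨by
      simp only [Matrix.cons_val_zero, map_mul, map_sub, apply_C, MvPolynomial.aeval_X,
        ← aeval_algHom_apply, Matrix.cons_val_one, length1Poly, MvPolynomial.algebraMap_eq]
      linear_combination 𝐱 * C_unit_mul_C_inv u, by simp⟩)
    (Fin.forall_fin_two.2 ⟨by
      simp only [Matrix.cons_val_zero, apply_length1Poly, MvPolynomial.aeval_X,
        Matrix.cons_val_one, MvPolynomial.algebraMap_eq]
      linear_combination (𝐱 - aeval 𝐲 g) * C_unit_mul_C_inv u, by simp⟩)

@[simp] lemma tri_x (u : Rˣ) (g : R[X]) : tri u g 𝐱 = length1Poly (u : R) g := by simp [tri]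
@[simp] lemma tri_y (u : Rˣ) (g : R[X]) : tri u g 𝐲 = 𝐲 := by simp [tri]

/-- The automorphism exchanging `x` and `y`. -/
def swap : GA 2 R :=
  MvPolynomial.renameEquiv R (Equiv.swap 0 1)

@[simp] lemma swap_x : (swap : GA 2 R) 𝐱 = 𝐲 := by simp [swap]
@[simp] lemma swap_y : (swap : GA 2 R) 𝐲 = 𝐱 := by simp [swap]

/-- The automorphism `x ↦ x`, `y ↦ u y + w`. -/
def scaleY (u : Rˣ) (w : R) : GA 2 R := swap * tri u (C w) * swap

@[simp] lemma scaleY_x (u : Rˣ) (w : R) : scaleY u w 𝐱 = 𝐱 := by simp [scaleY]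

@[simp] lemma scaleY_y (u : Rˣ) (w : R) :
    scaleY u w 𝐲 = MvPolynomial.C (u : R) * 𝐲 + MvPolynomial.C w := by
  simp [scaleY, length1Poly, MvPolynomial.algebraMap_eq]

lemma scaleY_inv_y (u : Rˣ) (w : R) :
    (scaleY u w)⁻¹ 𝐲 = MvPolynomial.C ((u⁻¹ : Rˣ) : R) * (𝐲 - MvPolynomial.C w) := by
  apply (scaleY u w).injective
  rw [GA_apply_inv_self, map_mul, map_sub, scaleY_y, GA_apply_C, GA_apply_C]
  linear_combination -𝐲 * C_unit_mul_C_inv u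

lemma mul_scaleY_inv_y {σ : GA 2 R} {u : Rˣ} {w : R} {f : MvPolynomial (Fin 2) R}
    (h : σ 𝐲 = MvPolynomial.C (u : R) * f + MvPolynomial.C w) :
    (σ * (scaleY u w)⁻¹) 𝐲 = f := by
  rw [AlgEquiv.mul_apply, scaleY_inv_y, map_mul, map_sub, GA_apply_C, GA_apply_C, h]
  linear_combination f * C_unit_mul_C_inv u

end Basic

/-! ### The Jacobian determinant -/

section Jacobian

variable {R S : Type*} [CommRing R] [CommRing S]

/-- The Jacobian determinant of a pair of polynomials in `x, y`. -/
def jacobian (P Q : MvPolynomial (Fin 2) R) : MvPolynomial (Fin 2) R :=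
  MvPolynomial.pderiv 0 P * MvPolynomial.pderiv 1 Q -
    MvPolynomial.pderiv 1 P * MvPolynomial.pderiv 0 Q

lemma pderiv_GA (σ : GA 2 R) (i : Fin 2) (P : MvPolynomial (Fin 2) R) :
    MvPolynomial.pderiv i (σ P) =
      σ (MvPolynomial.pderiv 0 P) * MvPolynomial.pderiv i (σ 𝐱) +
      σ (MvPolynomial.pderiv 1 P) * MvPolynomial.pderiv i (σ 𝐲) := by
  induction P using MvPolynomial.induction_on with
  | C r => simp
  | add p q hp hq => simp only [map_add, hp, hq]; ring
  | mul_X p j hp => fin_cases j <;> simp [hp] <;> ring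

lemma jacobian_GA (σ : GA 2 R) (P Q : MvPolynomial (Fin 2) R) :
    jacobian (σ P) (σ Q) = σ (jacobian P Q) * jacobian (σ 𝐱) (σ 𝐲) := by
  simp only [jacobian, pderiv_GA σ _ P, pderiv_GA σ _ Q, map_sub, map_mul]
  ring

lemma jacobian_map (φ : R →+* S) (P Q : MvPolynomial (Fin 2) R) :
    jacobian (MvPolynomial.map φ P) (MvPolynomial.map φ Q) =
      MvPolynomial.map φ (jacobian P Q) := by
  simp [jacobian, MvPolynomial.pderiv_map]

lemma isUnit_jacobian (σ : GA 2 R) : IsUnit (jacobian (σ 𝐱) (σ 𝐲)) := by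
  have h := jacobian_GA σ (σ⁻¹ 𝐱) (σ⁻¹ 𝐲)
  rw [GA_apply_inv_self, GA_apply_inv_self,
    show jacobian 𝐱 𝐲 = (1 : MvPolynomial (Fin 2) R) by simp [jacobian]] at h
  exact .of_mul_eq_one_right _ h.symm

lemma exists_jacobian_eq_C [IsReduced R] (σ : GA 2 R) :
    ∃ u : Rˣ, jacobian (σ 𝐱) (σ 𝐲) = MvPolynomial.C (u : R) := by
  obtain ⟨r, hr, h⟩ := MvPolynomial.isUnit_iff_eq_C_of_isReduced.1 (isUnit_jacobian σ)
  exact ⟨hr.unit, h⟩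

lemma pderiv_aeval (i : Fin 2) (P : MvPolynomial (Fin 2) R) (Q : R[X]) :
    MvPolynomial.pderiv i (aeval P Q) = aeval P (derivative Q) * MvPolynomial.pderiv i P := by
  rw [Derivation.map_aeval, smul_eq_mul]

lemma jacobian_length1Poly_y (p : R) (Q : R[X]) :
    jacobian (length1Poly p Q) 𝐲 = MvPolynomial.C p := by
  simp [jacobian, length1Poly]

lemma jacobian_C_mul_add_C_left (u w : R) (P Q : MvPolynomial (Fin 2) R) :
    jacobian (MvPolynomial.C u * P + MvPolynomial.C w) Q = MvPolynomial.C u * jacobian P Q := by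
  simp only [jacobian, map_add, Derivation.leibniz, MvPolynomial.pderiv_C, smul_eq_mul]
  ring

lemma jacobian_length2Poly (p₁ p₂ : R) (Q₁ Q₂ : R[X]) :
    jacobian (length1Poly p₁ Q₁) (length2Poly p₁ p₂ Q₁ Q₂) = MvPolynomial.C (p₁ * p₂) := by
  rw [length2Poly, ← length1Poly]
  simp only [jacobian, map_add, pderiv_aeval, Derivation.leibniz, MvPolynomial.pderiv_C,
    MvPolynomial.pderiv_X_self, smul_eq_mul,
    MvPolynomial.pderiv_X_of_ne (show (1 : Fin 2) ≠ 0 by decide)]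
  simp only [length1Poly, map_add, pderiv_aeval, Derivation.leibniz, MvPolynomial.pderiv_C,
    MvPolynomial.pderiv_X_self, smul_eq_mul, map_mul,
    MvPolynomial.pderiv_X_of_ne (show (1 : Fin 2) ≠ 0 by decide)]
  ring

end Jacobian

/-! ### Mates of a coordinate -/

section Mates

variable {R : Type*} [CommRing R]

/-- `R[x, y]` as the ring of polynomials in `x` over `R[y]`. -/
def polynomialX : MvPolynomial (Fin 2) R ≃ₐ[R] R[X][X] :=
  (Bivariate.equivMvPolynomial R).symm.trans Bivariate.swap

@[simp] lemma polynomialX_x : polynomialX (𝐱 : MvPolynomial (Fin 2) R) = X := by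
  simp [polynomialX, Bivariate.swap_apply]

@[simp] lemma polynomialX_y : polynomialX (𝐲 : MvPolynomial (Fin 2) R) = C X := by
  simp [polynomialX, Bivariate.swap_apply]

lemma polynomialX_aeval_y (Q : R[X]) :
    polynomialX (aeval (𝐲 : MvPolynomial (Fin 2) R) Q) = C Q := by
  rw [← aeval_algHom_apply, polynomialX_y]
  simpa using aeval_algebraMap_apply R[X][X] (X : R[X]) Q

lemma polynomialX_symm_C (Q : R[X]) :
    polynomialX.symm (C Q) = aeval (𝐲 : MvPolynomial (Fin 2) R) Q := by
  rw [AlgEquiv.symm_apply_eq, polynomialX_aeval_y]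

lemma polynomialX_GA {σ : GA 2 R} (h : σ 𝐲 = 𝐲) (P : MvPolynomial (Fin 2) R) :
    polynomialX (σ P) = (polynomialX P).comp (polynomialX (σ 𝐱)) := by
  induction P using MvPolynomial.induction_on with
  | C r => simp [apply_C, Polynomial.algebraMap_apply]
  | add p q hp hq => simp [hp, hq]
  | mul_X p j hp => fin_cases j <;> simp [hp, h]

lemma exists_eq_tri_of_apply_y_eq [IsDomain R] {σ : GA 2 R} (h : σ 𝐲 = 𝐲) :
    ∃ (u : Rˣ) (g : R[X]), σ = tri u g := by
  have hcomp := polynomialX_GA h (σ⁻¹ 𝐱)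
  rw [GA_apply_inv_self, polynomialX_x] at hcomp
  have hdeg : (polynomialX (σ 𝐱)).natDegree = 1 := by
    have := congrArg natDegree hcomp
    rw [natDegree_X, natDegree_comp] at this
    exact Nat.eq_one_of_mul_eq_one_left this.symm
  obtain ⟨a, b, hab⟩ : ∃ a b : R[X], σ 𝐱 = aeval 𝐲 a * 𝐱 + aeval 𝐲 b := by
    have := congrArg polynomialX.symm (eq_X_add_C_of_natDegree_le_one hdeg.le)
    rw [AlgEquiv.symm_apply_apply, map_add, map_mul, polynomialX_symm_C, polynomialX_symm_C,
      ← polynomialX_x, AlgEquiv.symm_apply_apply] at this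
    exact ⟨_, _, this⟩
  obtain ⟨u, hu⟩ := exists_jacobian_eq_C σ
  have ha : jacobian (σ 𝐱) (σ 𝐲) = aeval 𝐲 a := by rw [h, hab]; simp [jacobian]
  exact ⟨u, b, GA_ext_two (by rw [tri_x, hab, ← ha, hu, length1Poly]) (by rw [tri_y, h])⟩

lemma exists_eq_mul_tri [IsDomain R] {σ τ : GA 2 R} (h : σ 𝐲 = τ 𝐲) :
    ∃ (u : Rˣ) (g : R[X]), σ = τ * tri u g := by
  obtain ⟨u, g, hg⟩ := exists_eq_tri_of_apply_y_eq (σ := τ⁻¹ * σ)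
    (by rw [AlgEquiv.mul_apply, h, GA_inv_apply_self])
  exact ⟨u, g, by rw [← hg, mul_inv_cancel_left]⟩

lemma mul_tri_x (τ : GA 2 R) (u : Rˣ) (g : R[X]) :
    (τ * tri u g) 𝐱 = MvPolynomial.C (u : R) * τ 𝐱 + aeval (τ 𝐲) g := by
  rw [AlgEquiv.mul_apply, tri_x, GA_length1Poly]

lemma mul_tri_y (τ : GA 2 R) (u : Rˣ) (g : R[X]) : (τ * tri u g) 𝐲 = τ 𝐲 := by
  rw [AlgEquiv.mul_apply, tri_y]

lemma exists_apply_x_eq_of_apply_y_eq [IsDomain R] {σ τ : GA 2 R} (h : σ 𝐲 = τ 𝐲) :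
    ∃ (u : Rˣ) (g : R[X]), σ 𝐱 = MvPolynomial.C (u : R) * τ 𝐱 + aeval (τ 𝐲) g := by
  obtain ⟨u, g, rfl⟩ := exists_eq_mul_tri h
  exact ⟨u, g, mul_tri_x τ u g⟩

end Mates

/-! ### Reduction modulo `p` -/

section Reduction

lemma sub_dvd_aeval_sub {R A : Type*} [CommRing R] [CommRing A] [Algebra R A] (a b : A)
    (P : R[X]) : a - b ∣ aeval a P - aeval b P := by
  simpa only [eval_map_algebraMap] using sub_dvd_eval_sub a b (P.map (algebraMap R A))

lemma C_dvd_sub_iff_map_mk_eq {R : Type*} [CommRing R] {p : R} {P Q : R[X]} :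
    C p ∣ P - Q ↔ P.map (Ideal.Quotient.mk (Ideal.span {p})) =
      Q.map (Ideal.Quotient.mk (Ideal.span {p})) := by
  rw [C_dvd_iff_dvd_coeff]
  simp only [coeff_sub, ← Ideal.mem_span_singleton, ← Ideal.Quotient.eq, Polynomial.ext_iff,
    coeff_map]

lemma C_dvd_comp_sub_X {R : Type*} [CommRing R] {p : R} {P Q : R[X]}
    {s : (R ⧸ Ideal.span {p})[X] ≃ₐ[R ⧸ Ideal.span {p}] (R ⧸ Ideal.span {p})[X]}
    (hP : P.map (Ideal.Quotient.mk _) = s.symm X) (hQ : Q.map (Ideal.Quotient.mk _) = s X) :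
    C p ∣ P.comp Q - X := by
  rw [C_dvd_sub_iff_map_mk_eq, Polynomial.map_comp, hP, hQ, comp_eq_aeval, aeval_algHom_apply,
    aeval_X_left_apply, AlgEquiv.apply_symm_apply, Polynomial.map_X]

variable {R : Type*} [CommRing R]

lemma C_dvd_y_sub_aeval_length1Poly {p : R} {P Q : R[X]} (h : C p ∣ P.comp Q - X) :
    MvPolynomial.C p ∣ 𝐲 - aeval (length1Poly p Q) P := by
  have hE : MvPolynomial.C p ∣ aeval 𝐲 (P.comp Q - X) := by
    simpa [MvPolynomial.algebraMap_eq] using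
      map_dvd (aeval (𝐲 : MvPolynomial (Fin 2) R)) h
  have hx : MvPolynomial.C p ∣ length1Poly p Q - aeval 𝐲 Q := by simp [length1Poly]
  have hdvd := (hx.trans (sub_dvd_aeval_sub _ _ P)).add hE
  rw [map_sub, aeval_comp, aeval_X] at hdvd
  rw [dvd_sub_comm]
  convert hdvd using 1
  ring

lemma C_mul_left_cancel {p : R} (hp : p ∈ nonZeroDivisors R) {P Q : MvPolynomial (Fin 2) R}
    (h : MvPolynomial.C p * P = MvPolynomial.C p * Q) : P = Q := by
  ext m
  have := congrArg (MvPolynomial.coeff m) h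
  rwa [MvPolynomial.coeff_C_mul, MvPolynomial.coeff_C_mul,
    mul_cancel_left_mem_nonZeroDivisors hp] at this

lemma aeval_mate_eq_X {p : R} (hp : p ∈ nonZeroDivisors R) {P Q : R[X]}
    {g g' : MvPolynomial (Fin 2) R}
    (hg : 𝐲 - aeval (length1Poly p Q) P = MvPolynomial.C p * g)
    (hg' : 𝐲 - aeval (length1Poly p P) Q = MvPolynomial.C p * g') (i : Fin 2) :
    MvPolynomial.aeval ![g, length1Poly p Q] (![g', length1Poly p P] i) = MvPolynomial.X i := by
  have hy : MvPolynomial.aeval ![g, length1Poly p Q] (length1Poly p P) = 𝐲 := by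
    simp only [apply_length1Poly, MvPolynomial.aeval_X, MvPolynomial.algebraMap_eq,
      Matrix.cons_val_zero, Matrix.cons_val_one]
    linear_combination -hg
  fin_cases i
  · have := congrArg (MvPolynomial.aeval ![g, length1Poly p Q]) hg'
    rw [map_mul, map_sub, ← aeval_algHom_apply, hy, apply_C,
      MvPolynomial.aeval_X, MvPolynomial.algebraMap_eq] at this
    refine C_mul_left_cancel hp ?_
    simpa [length1Poly] using this.symm
  · exact hy

lemma length1Poly_mem_VA₂_of_map_mk_mem_VA₁ {p : R} (hp : p ∈ nonZeroDivisors R) {Q : R[X]}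
    (h : Q.map (Ideal.Quotient.mk (Ideal.span {p})) ∈ VA₁ (R ⧸ Ideal.span {p})) :
    length1Poly p Q ∈ VA₂ R := by
  obtain ⟨s, hs⟩ := h
  obtain ⟨P, hP⟩ := map_surjective _ Ideal.Quotient.mk_surjective (s.symm X)
  obtain ⟨g, hg⟩ := C_dvd_y_sub_aeval_length1Poly (C_dvd_comp_sub_X hP hs.symm)
  obtain ⟨g', hg'⟩ := C_dvd_y_sub_aeval_length1Poly (C_dvd_comp_sub_X (s := s.symm) hs.symm hP)
  exact ⟨mkGA ![g, length1Poly p Q] ![g', length1Poly p P] (aeval_mate_eq_X hp hg hg')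
    (aeval_mate_eq_X hp hg' hg), by simp⟩

lemma eval_coeff_zero_of_comp_eq_C {φ W : R[X]} {b : R} (h : φ.comp W = C b) :
    φ.eval (W.coeff 0) = b := by
  simpa [coeff_zero_eq_eval_zero, eval_comp] using congrArg (eval 0) h

lemma eq_C_coeff_zero_of_comp_eq_C {φ W : R[X]} {b : R} (h : φ.comp W = C b)
    (hφ : φ.derivative.eval (W.coeff 0) ∈ nonZeroDivisors R) : W = C (W.coeff 0) := by
  set D := W - C (W.coeff 0) with hD
  obtain ⟨z, hz⟩ := (φ.map C).binomExpansion (C (W.coeff 0)) D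
  have hfactor : D * (C (φ.derivative.eval (W.coeff 0)) + z * D) = 0 := by
    rw [hD, add_sub_cancel, ← hD, derivative_map, eval_map, eval_map, eval_map, ← comp, h,
      eval₂_at_apply, eval₂_at_apply, eval_coeff_zero_of_comp_eq_C h] at hz
    linear_combination -hz
  have hreg : C (φ.derivative.eval (W.coeff 0)) + z * D ∈ nonZeroDivisors R[X] :=
    mem_nonzeroDivisors_of_coeff_mem 0 (by simpa [mul_coeff_zero, hD] using hφ)
  exact sub_eq_zero.1 (hreg.2 _ hfactor)

lemma mem_VA₁_of_aeval_y_mem_VA₂ {q : R[X]} (h : aeval 𝐲 q ∈ VA₂ R) : q ∈ VA₁ R := by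
  obtain ⟨ρ, hρ⟩ := h
  set W := polynomialX (ρ⁻¹ 𝐲)
  set k := W.coeff 0
  have hW : (q.map C).comp W = C X := by
    rw [← polynomialX_y, ← GA_inv_apply_self ρ 𝐲, hρ, GA_aeval, ← aeval_algHom_apply, comp,
      eval₂_map]
    rfl
  have hqk : q.comp k = X := by
    rw [comp, ← eval_map, eval_coeff_zero_of_comp_eq_C hW]
  have hunit : IsUnit ((q.map C).derivative.eval k) := by
    rw [derivative_map, eval_map, ← comp]
    exact .of_mul_eq_one_right _ (by rw [← derivative_comp, hqk, derivative_X])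
  have hk : ρ⁻¹ 𝐲 = aeval 𝐲 k := by
    rw [← polynomialX_symm_C, AlgEquiv.eq_symm_apply]
    exact eq_C_coeff_zero_of_comp_eq_C hW hunit.mem_nonZeroDivisors
  have hkq : k.comp q = X := by
    apply C_injective
    rw [← polynomialX_aeval_y, ← polynomialX_y, aeval_comp, ← hρ, ← GA_aeval, ← hk,
      GA_apply_inv_self]
  exact ⟨algEquivOfCompEqX q k hqk hkq, by simp⟩

lemma map_mk_mem_VA₁_of_length1Poly_mem_VA₂ {p : R} {Q : R[X]} (h : length1Poly p Q ∈ VA₂ R) :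
    Q.map (Ideal.Quotient.mk (Ideal.span {p})) ∈ VA₁ (R ⧸ Ideal.span {p}) := by
  obtain ⟨σ, hσ⟩ := h
  refine mem_VA₁_of_aeval_y_mem_VA₂ ⟨baseChange (Ideal.Quotient.mk (Ideal.span {p})) σ, ?_⟩
  rw [baseChange_X, hσ, map_length1Poly, Ideal.Quotient.mk_singleton_self, length1Poly, map_zero,
    zero_mul, zero_add]

theorem length1Poly_mem_VA₂_iff {p : R} (hp : p ∈ nonZeroDivisors R) {Q : R[X]} :
    length1Poly p Q ∈ VA₂ R ↔
      Q.map (Ideal.Quotient.mk (Ideal.span {p})) ∈ VA₁ (R ⧸ Ideal.span {p}) :=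
  ⟨map_mk_mem_VA₁_of_length1Poly_mem_VA₂, length1Poly_mem_VA₂_of_map_mk_mem_VA₁ hp⟩

end Reduction

/-! ### Comparison with automorphisms over a larger ring -/

section Comparison

variable {R S K : Type*} [CommRing R] [CommRing S] [Field K]

/-- The automorphism `x ↦ y`, `y ↦ u x + Q(y)`. -/
def length1GA (u : Rˣ) (Q : R[X]) : GA 2 R := tri u Q * swap

@[simp] lemma length1GA_x (u : Rˣ) (Q : R[X]) : length1GA u Q 𝐱 = 𝐲 := by simp [length1GA]

@[simp] lemma length1GA_y (u : Rˣ) (Q : R[X]) : length1GA u Q 𝐲 = length1Poly (u : R) Q := by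
  simp [length1GA]

lemma length2Poly_eq_aeval (p₁ p₂ : R) (Q₁ Q₂ : R[X]) :
    length2Poly p₁ p₂ Q₁ Q₂ = MvPolynomial.C p₂ * 𝐲 + aeval (length1Poly p₁ Q₁) Q₂ :=
  rfl

/-- The automorphism `x ↦ u₁ x + Q₁(y)`, `y ↦ u₂ y + Q₂(u₁ x + Q₁(y))`. -/
def length2GA (u₁ u₂ : Rˣ) (Q₁ Q₂ : R[X]) : GA 2 R := length1GA u₁ Q₁ * length1GA u₂ Q₂

@[simp] lemma length2GA_x (u₁ u₂ : Rˣ) (Q₁ Q₂ : R[X]) :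
    length2GA u₁ u₂ Q₁ Q₂ 𝐱 = length1Poly (u₁ : R) Q₁ := by
  simp [length2GA]

@[simp] lemma length2GA_y (u₁ u₂ : Rˣ) (Q₁ Q₂ : R[X]) :
    length2GA u₁ u₂ Q₁ Q₂ 𝐲 = length2Poly (u₁ : R) u₂ Q₁ Q₂ := by
  simp [length2GA, GA_length1Poly, length2Poly_eq_aeval]

lemma isUnit_of_C_mul_add_C_mem_VA₂ {f : MvPolynomial (Fin 2) R} {c w : R}
    (h : MvPolynomial.C c * f + MvPolynomial.C w ∈ VA₂ R) : IsUnit c := by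
  obtain ⟨σ, hσ⟩ := h
  have hy : MvPolynomial.C c * σ⁻¹ f + MvPolynomial.C w = 𝐲 := by
    simpa using (congrArg (σ⁻¹ ·) hσ).symm
  have hcoeff := congrArg (fun P => (restrictCurve 0 X P).coeff 1) hy
  simp only [map_add, map_mul, restrictCurve_C, restrictCurve_y, coeff_add, coeff_C_mul,
    coeff_C_succ, add_zero, coeff_X_one] at hcoeff
  exact .of_mul_eq_one _ hcoeff

lemma mem_VA₂_of_C_mul_add_C_mem_VA₂ {f : MvPolynomial (Fin 2) R} {u : Rˣ} {w : R}
    (h : MvPolynomial.C (u : R) * f + MvPolynomial.C w ∈ VA₂ R) : f ∈ VA₂ R := by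
  obtain ⟨σ, hσ⟩ := h
  exact ⟨σ * (scaleY u w)⁻¹, mul_scaleY_inv_y hσ⟩

lemma exists_unit_of_map_eq_C_mul_add_C [IsDomain R] [DecompositionMonoid R[X]] {φ : R →+* S}
    (hφ : Function.Injective φ) {p : R} (hp : p ≠ 0) {Q : R[X]} (hQ : Q.eval 0 = 0)
    (hpQ : IsRelPrime (C p) Q) {g : MvPolynomial (Fin 2) R} (hg : g ∈ VA₂ R) {c s : S}
    (h : MvPolynomial.map φ g =
      MvPolynomial.C c * MvPolynomial.map φ (length1Poly p Q) + MvPolynomial.C s) :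
    ∃ (u : Rˣ) (w : R), g = MvPolynomial.C (u : R) * length1Poly p Q + MvPolynomial.C w := by
  rw [map_length1Poly, C_mul_length1Poly_add_C] at h
  obtain ⟨p', Q', rfl, hp', hQ'⟩ := exists_eq_length1Poly_of_map hφ h
  set w := Q'.eval 0
  have hw : φ w = s := by
    rw [← eval_zero_map, hQ', eval_add, eval_mul, eval_zero_map, hQ, map_zero, mul_zero, zero_add,
      eval_C]
  have hprop : C p' * Q = C p * (Q' - C w) := by
    apply map_injective φ hφ
    rw [Polynomial.map_mul, Polynomial.map_mul, Polynomial.map_sub, map_C, map_C, map_C, hp',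
      hQ', hw, C_mul]
    ring
  obtain ⟨c', rfl⟩ : p ∣ p' := by
    have hdvd : C p ∣ C p' := hpQ.dvd_of_dvd_mul_right (hprop ▸ dvd_mul_right _ _)
    simpa using (C_dvd_iff_dvd_coeff _ _).1 hdvd 0
  have hQ'w : Q' = C c' * Q + C w := by
    rw [← sub_eq_iff_eq_add]
    apply mul_left_cancel₀ (C_ne_zero.2 hp)
    rw [← hprop, C_mul, mul_assoc]
  rw [hQ'w, mul_comm, ← C_mul_length1Poly_add_C] at hg ⊢
  exact ⟨(isUnit_of_C_mul_add_C_mem_VA₂ hg).unit, w, rfl⟩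

lemma exists_eq_apply_length1Poly_of_map [IsDomain R] [IsDomain S] {φ : R →+* S}
    (hφ : Function.Injective φ) {σ : GA 2 R} {Ψ : GA 2 S} {P : MvPolynomial (Fin 2) R}
    (hy : Ψ 𝐲 = MvPolynomial.map φ (σ 𝐲)) (hx : Ψ 𝐱 = MvPolynomial.map φ P) :
    ∃ c g, c ≠ 0 ∧ P = σ (length1Poly c g) := by
  obtain ⟨u, g, hu⟩ := exists_apply_x_eq_of_apply_y_eq (hy.trans (baseChange_X φ σ 1).symm)
  have hmap : MvPolynomial.map φ (σ⁻¹ P) = length1Poly (u : S) g := by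
    apply (baseChange φ σ).injective
    rw [baseChange_map, GA_apply_inv_self, ← hx, hu, GA_length1Poly]
  obtain ⟨c, g', hc, hcu, -⟩ := exists_eq_length1Poly_of_map hφ hmap
  refine ⟨c, g', ?_, by rw [← hc, GA_apply_inv_self]⟩
  rintro rfl
  exact u.ne_zero (by rw [← hcu, map_zero])

lemma exists_map_apply_y_eq {φ : R →+* K} (hφ : Function.Injective φ) {η : GA 2 R} {m : R}
    (hm : m ≠ 0) {B : R[X]} {Ψ : GA 2 K}
    (h : Ψ 𝐲 = MvPolynomial.map φ (η (length1Poly m B))) :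
    ∃ (u : Kˣ) (k : K[X]),
      MvPolynomial.map φ (η 𝐲) = MvPolynomial.C (u : K) * Ψ 𝐱 + aeval (Ψ 𝐲) k := by
  let v : Kˣ := Units.mk0 (φ m) ((map_ne_zero_iff φ hφ).2 hm)
  have hy : (baseChange φ η * length1GA v (B.map φ)) 𝐲 = Ψ 𝐲 := by
    rw [AlgEquiv.mul_apply, length1GA_y, Units.val_mk0, ← map_length1Poly, baseChange_map, h]
  obtain ⟨u, k, hk⟩ := exists_apply_x_eq_of_apply_y_eq hy
  exact ⟨u, k, by rw [← hk, AlgEquiv.mul_apply, length1GA_x, baseChange_X]⟩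

end Comparison

/-! ### Mates of length one and length "1+1" -/

section LengthTwo

variable {R K : Type*} [CommRing R] [Field K] {φ : R →+* K} {p₁ : R} {p₂ : K}
  {Q₁ : R[X]} {Q₂ : K[X]} {F : MvPolynomial (Fin 2) R}

lemma natDegree_eq_zero_of_length1Poly_eq {S : Type*} [CommRing S] [IsDomain S] {a p p₂ u : S}
    {A P Q k : S[X]} (hp : p ≠ 0) (hQ : 2 ≤ Q.natDegree)
    (h : length1Poly a A =
      MvPolynomial.C u * length1Poly p P + aeval (length2Poly p p₂ P Q) k) :
    k.natDegree = 0 := by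
  have hline := congrArg (restrictCurve X 0) h
  simp only [length2Poly_eq_aeval, map_add, map_mul, restrictCurve_aeval, restrictCurve_length1Poly,
    restrictCurve_C, restrictCurve_y, mul_zero, zero_add, comp_zero] at hline
  have hk : k.comp (Q.comp (C p * X + C (P.eval 0))) =
      C (a - u * p) * X + C (A.eval 0 - u * P.eval 0) := by
    simp only [C_sub, C_mul]
    linear_combination -hline
  have hdeg := natDegree_linear_le (a := a - u * p) (b := A.eval 0 - u * P.eval 0)
  rw [← hk, natDegree_comp, natDegree_comp, natDegree_linear hp, mul_one] at hdeg
  nlinarith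

lemma exists_length2GA (hφ : Function.Injective φ) (hp₁ : p₁ ≠ 0) (hp₂ : p₂ ≠ 0)
    (hF : MvPolynomial.map φ F = length2Poly (φ p₁) p₂ (Q₁.map φ) Q₂) :
    ∃ Ψ : GA 2 K, Ψ 𝐱 = MvPolynomial.map φ (length1Poly p₁ Q₁) ∧ Ψ 𝐲 = MvPolynomial.map φ F :=
  ⟨length2GA (.mk0 (φ p₁) ((map_ne_zero_iff φ hφ).2 hp₁)) (.mk0 p₂ hp₂) (Q₁.map φ) Q₂,
    by simp [map_length1Poly], by simp [hF]⟩

lemma map_jacobian_length1Poly (hF : MvPolynomial.map φ F = length2Poly (φ p₁) p₂ (Q₁.map φ) Q₂) :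
    MvPolynomial.map φ (jacobian (length1Poly p₁ Q₁) F) = MvPolynomial.C (φ p₁ * p₂) := by
  rw [← jacobian_map, hF, map_length1Poly, jacobian_length2Poly]

variable [IsDomain R]

lemma exists_apply_y_eq_of_apply_length1Poly_eq [DecompositionMonoid R[X]]
    (hφ : Function.Injective φ) (hp₁ : p₁ ≠ 0) (hp₂ : p₂ ≠ 0) (hQ₁ : Q₁.eval 0 = 0)
    (hpQ : IsRelPrime (C p₁) Q₁) (hQ₂ : 2 ≤ Q₂.natDegree)
    (hF : MvPolynomial.map φ F = length2Poly (φ p₁) p₂ (Q₁.map φ) Q₂) {σ : GA 2 R}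
    (hσ : σ 𝐲 ∈ B1 R) {b : R} (hb : b ≠ 0) {B : R[X]} (hFσ : σ (length1Poly b B) = F) :
    ∃ (u : Rˣ) (w : R), σ 𝐲 = MvPolynomial.C (u : R) * length1Poly p₁ Q₁ + MvPolynomial.C w := by
  obtain ⟨Ψ, hΨx, hΨy⟩ := exists_length2GA hφ hp₁ hp₂ hF
  obtain ⟨u, k, hk⟩ := exists_map_apply_y_eq hφ hb (hΨy.trans (by rw [hFσ]))
  obtain ⟨a, A, -, hA⟩ := mem_B1_iff.1 hσ
  have hk0 : k.natDegree = 0 := by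
    refine natDegree_eq_zero_of_length1Poly_eq ((map_ne_zero_iff φ hφ).2 hp₁) hQ₂ ?_
      (a := φ a) (A := A.map φ) (P := Q₁.map φ) (u := (u : K)) (p₂ := p₂)
    rw [← map_length1Poly, ← hA, hk, hΨx, hΨy, hF, map_length1Poly]
  rw [hΨx, eq_C_of_natDegree_eq_zero hk0, aeval_C, MvPolynomial.algebraMap_eq] at hk
  exact exists_unit_of_map_eq_C_mul_add_C hφ hp₁ hQ₁ hpQ ⟨σ, rfl⟩ hk

lemma exists_unit_of_hasMateOfLengthOne [DecompositionMonoid R[X]]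
    (hφ : Function.Injective φ) (hp₁ : p₁ ≠ 0) (hp₂ : p₂ ≠ 0) (hQ₁ : Q₁.eval 0 = 0)
    (hpQ : IsRelPrime (C p₁) Q₁) (hQ₂ : 2 ≤ Q₂.natDegree)
    (hF : MvPolynomial.map φ F = length2Poly (φ p₁) p₂ (Q₁.map φ) Q₂)
    (h : HasMateOfLengthOne F) : ∃ u : Rˣ, φ p₁ * p₂ = φ u := by
  obtain ⟨G, hG, σ, hx, rfl⟩ := h
  obtain ⟨u, w, hu⟩ := exists_apply_y_eq_of_apply_length1Poly_eq hφ hp₁ hp₂ hQ₁ hpQ hQ₂ hF hG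
    one_ne_zero (B := 0) (by simp [length1Poly, hx])
  obtain ⟨v, hv⟩ := exists_jacobian_eq_C (σ * swap)
  rw [AlgEquiv.mul_apply, AlgEquiv.mul_apply, swap_x, swap_y, hu, hx,
    jacobian_C_mul_add_C_left] at hv
  refine ⟨u⁻¹ * v, MvPolynomial.C_injective (Fin 2) K ?_⟩
  rw [← map_jacobian_length1Poly hF, ← MvPolynomial.map_C, Units.val_mul, map_mul, ← hv]
  congr 1
  linear_combination -jacobian (length1Poly p₁ Q₁) F * C_unit_mul_C_inv u

lemma hasMateOfLengthOne_of_unit (hφ : Function.Injective φ) (hp₁ : p₁ ≠ 0) (hp₂ : p₂ ≠ 0)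
    (hF : MvPolynomial.map φ F = length2Poly (φ p₁) p₂ (Q₁.map φ) Q₂) (hcoord : F ∈ VA₂ R)
    {u : Rˣ} (hu : φ p₁ * p₂ = φ u) : HasMateOfLengthOne F := by
  obtain ⟨ρ, rfl⟩ := hcoord
  obtain ⟨Ψ, hΨx, hΨy⟩ := exists_length2GA hφ hp₁ hp₂ hF
  obtain ⟨c, g, -, hf⟩ := exists_eq_apply_length1Poly_of_map hφ hΨy hΨx
  obtain ⟨v, hv⟩ := exists_jacobian_eq_C ρ
  have hcv : c * v = u := by
    apply hφ
    apply MvPolynomial.C_injective (Fin 2) K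
    rw [← hu, ← map_jacobian_length1Poly hF, hf, jacobian_GA, hv, jacobian_length1Poly_y,
      GA_apply_C, ← map_mul, MvPolynomial.map_C]
  have hc : IsUnit c := isUnit_of_mul_isUnit_left (hcv ▸ u.isUnit)
  refine ⟨length1Poly p₁ Q₁, length1Poly_mem_B1 hp₁ Q₁, ρ * tri hc.unit g * swap, ?_, ?_⟩
  · simp
  · simp [hf]

lemma length1Poly_mem_VA₂_of_hasLengthOnePlusOne [DecompositionMonoid R[X]]
    (hφ : Function.Injective φ) (hp₁ : p₁ ≠ 0) (hp₂ : p₂ ≠ 0) (hQ₁ : Q₁.eval 0 = 0)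
    (hpQ : IsRelPrime (C p₁) Q₁) (hQ₂ : 2 ≤ Q₂.natDegree)
    (hF : MvPolynomial.map φ F = length2Poly (φ p₁) p₂ (Q₁.map φ) Q₂)
    (h : HasLengthOnePlusOne F) : length1Poly p₁ Q₁ ∈ VA₂ R := by
  obtain ⟨σ, τ, hσ, hτ, hστ⟩ := h
  obtain ⟨b, B, hb, hB⟩ := mem_B1_iff.1 hτ
  rw [AlgEquiv.mul_apply, hB] at hστ
  obtain ⟨u, w, hu⟩ :=
    exists_apply_y_eq_of_apply_length1Poly_eq hφ hp₁ hp₂ hQ₁ hpQ hQ₂ hF hσ hb hστ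
  exact mem_VA₂_of_C_mul_add_C_mem_VA₂ (u := u) (w := w) ⟨σ, hu⟩

lemma hasLengthOnePlusOne_of_length1Poly_mem_VA₂ (hφ : Function.Injective φ) (hp₁ : p₁ ≠ 0)
    (hp₂ : p₂ ≠ 0) (hF : MvPolynomial.map φ F = length2Poly (φ p₁) p₂ (Q₁.map φ) Q₂)
    (hcoord : F ∈ VA₂ R) (h : length1Poly p₁ Q₁ ∈ VA₂ R) : HasLengthOnePlusOne F := by
  obtain ⟨ρ, hρ⟩ := hcoord
  obtain ⟨σ, hσ⟩ := h
  obtain ⟨Ψ, hΨx, hΨy⟩ := exists_length2GA hφ hp₁ hp₂ hF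
  obtain ⟨c, g, hc, hFσ⟩ := exists_eq_apply_length1Poly_of_map hφ (σ := σ) (Ψ := Ψ * swap)
    (P := F) (by simp [hΨx, hσ]) (by simp [hΨy])
  refine ⟨σ, σ⁻¹ * ρ, hσ ▸ length1Poly_mem_B1 hp₁ Q₁, ?_, by simp [hρ]⟩
  rw [AlgEquiv.mul_apply, hρ, hFσ, GA_inv_apply_self]
  exact length1Poly_mem_B1 hc g

lemma HasMateOfLengthOne.hasLengthOnePlusOne (h : HasMateOfLengthOne F) :
    HasLengthOnePlusOne F := by
  obtain ⟨G, hG, σ, hx, hy⟩ := h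
  refine ⟨σ, swap, hy ▸ hG, ?_, by simp [hx]⟩
  rw [swap_y]
  simpa [length1Poly] using length1Poly_mem_B1 (one_ne_zero (α := R)) 0

end LengthTwo

/-! ### Total degrees -/

section Degree

variable {ι R : Type*} [CommRing R]

lemma totalDegree_map_of_injective {S : Type*} [CommRing S] {φ : R →+* S}
    (hφ : Function.Injective φ) (P : MvPolynomial ι R) :
    (MvPolynomial.map φ P).totalDegree = P.totalDegree := by
  rw [MvPolynomial.totalDegree, MvPolynomial.totalDegree,
    MvPolynomial.support_map_of_injective _ hφ]

lemma totalDegree_C_mul_le (c : R) (P : MvPolynomial ι R) :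
    (MvPolynomial.C c * P).totalDegree ≤ P.totalDegree := by
  rw [← MvPolynomial.smul_eq_C_mul]
  exact MvPolynomial.totalDegree_smul_le c P

lemma totalDegree_aeval_le (P : MvPolynomial ι R) (Q : R[X]) :
    (aeval P Q).totalDegree ≤ Q.natDegree * P.totalDegree := by
  rw [aeval_eq_sum_range]
  refine MvPolynomial.totalDegree_finsetSum_le fun i hi => ?_
  calc (Q.coeff i • P ^ i).totalDegree ≤ (P ^ i).totalDegree := MvPolynomial.totalDegree_smul_le _ _
    _ ≤ i * P.totalDegree := MvPolynomial.totalDegree_pow _ _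
    _ ≤ Q.natDegree * P.totalDegree :=
      Nat.mul_le_mul_right _ (Nat.lt_succ_iff.1 (Finset.mem_range.1 hi))

lemma totalDegree_length1Poly_le [Nontrivial R] (p : R) (Q : R[X]) :
    (length1Poly p Q).totalDegree ≤ max 1 Q.natDegree := by
  refine (MvPolynomial.totalDegree_add _ _).trans (max_le_max ?_ ?_)
  · exact (totalDegree_C_mul_le _ _).trans (MvPolynomial.totalDegree_X _).le
  · simpa using totalDegree_aeval_le (𝐲 : MvPolynomial (Fin 2) R) Q

lemma natDegree_restrictCurve_le {a b : R[X]} (ha : a.natDegree ≤ 1) (hb : b.natDegree ≤ 1)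
    (P : MvPolynomial (Fin 2) R) : (restrictCurve a b P).natDegree ≤ P.totalDegree :=
  (MvPolynomial.aeval_natDegree_le P le_rfl _ (Fin.forall_fin_two.2 ⟨ha, hb⟩)).trans_eq
    (mul_one _)

lemma one_le_totalDegree_length1Poly {p : R} (hp : p ≠ 0) (Q : R[X]) :
    1 ≤ (length1Poly p Q).totalDegree := by
  have h := natDegree_restrictCurve_le natDegree_X_le (by simp : (0 : R[X]).natDegree ≤ 1)
    (length1Poly p Q)
  rwa [restrictCurve_length1Poly, comp_zero, natDegree_linear hp] at h

lemma natDegree_le_totalDegree_length1Poly (p : R) (Q : R[X]) :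
    Q.natDegree ≤ (length1Poly p Q).totalDegree := by
  have h := natDegree_restrictCurve_le (by simp : (0 : R[X]).natDegree ≤ 1) natDegree_X_le
    (length1Poly p Q)
  rwa [restrictCurve_length1Poly, mul_zero, zero_add, comp_X] at h

variable [IsDomain R]

lemma totalDegree_C_mul {c : R} (hc : c ≠ 0) (P : MvPolynomial ι R) :
    (MvPolynomial.C c * P).totalDegree = P.totalDegree := by
  rcases eq_or_ne P 0 with rfl | hP
  · rw [mul_zero]
  · rw [MvPolynomial.totalDegree_mul_of_isDomain (MvPolynomial.C_ne_zero.2 hc) hP,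
      MvPolynomial.totalDegree_C, zero_add]

lemma totalDegree_C_mul_add_C {c : R} (hc : c ≠ 0) {P : MvPolynomial ι R}
    (hP : 1 ≤ P.totalDegree) (w : R) :
    (MvPolynomial.C c * P + MvPolynomial.C w).totalDegree = P.totalDegree := by
  rw [MvPolynomial.totalDegree_add_eq_left_of_totalDegree_lt] <;> rw [totalDegree_C_mul hc]
  rwa [MvPolynomial.totalDegree_C]

lemma totalDegree_pow_of_isDomain (P : MvPolynomial ι R) (n : ℕ) :
    (P ^ n).totalDegree = n * P.totalDegree := by
  rcases eq_or_ne P 0 with rfl | hP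
  · cases n <;> simp
  induction n with
  | zero => simp
  | succ n ih =>
    rw [pow_succ, MvPolynomial.totalDegree_mul_of_isDomain (pow_ne_zero n hP) hP, ih,
      Nat.succ_mul]

lemma totalDegree_aeval {P : MvPolynomial ι R} (hP : 1 ≤ P.totalDegree) (Q : R[X]) :
    (aeval P Q).totalDegree = Q.natDegree * P.totalDegree := by
  rcases Nat.eq_zero_or_pos Q.natDegree with h0 | hpos
  · rw [h0, zero_mul, eq_C_of_natDegree_eq_zero h0, aeval_C, MvPolynomial.algebraMap_eq,
      MvPolynomial.totalDegree_C]
  have hQ : Q ≠ 0 := by rintro rfl; simp at hpos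
  have htop : (MvPolynomial.C Q.leadingCoeff * P ^ Q.natDegree).totalDegree =
      Q.natDegree * P.totalDegree := by
    rw [totalDegree_C_mul (leadingCoeff_ne_zero.2 hQ), totalDegree_pow_of_isDomain]
  have hrest : (aeval P Q.eraseLead).totalDegree < Q.natDegree * P.totalDegree := by
    rcases eraseLead_natDegree_lt_or_eraseLead_eq_zero Q with h | h
    · exact (totalDegree_aeval_le _ _).trans_lt (Nat.mul_lt_mul_of_pos_right h hP)
    · rw [h, map_zero, MvPolynomial.totalDegree_zero]
      exact Nat.mul_pos hpos hP
  rw [← eraseLead_add_C_mul_X_pow Q, map_add, map_mul, aeval_C, map_pow, aeval_X,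
    MvPolynomial.algebraMap_eq, MvPolynomial.totalDegree_add_eq_right_of_totalDegree_lt,
    htop, eraseLead_add_C_mul_X_pow]
  rwa [htop]

lemma one_le_totalDegree_GA {n : ℕ} (σ : GA n R) (i : Fin n) :
    1 ≤ (σ (MvPolynomial.X i)).totalDegree := by
  rw [Nat.one_le_iff_ne_zero, Ne, MvPolynomial.totalDegree_eq_zero_iff_eq_C]
  intro h
  have hX := congrArg MvPolynomial.totalDegree (σ.injective (h.trans (GA_apply_C σ _).symm))
  rw [MvPolynomial.totalDegree_X, MvPolynomial.totalDegree_C] at hX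
  exact one_ne_zero hX

lemma totalDegree_length2Poly {p₁ : R} (hp₁ : p₁ ≠ 0) (p₂ : R) (Q₁ : R[X]) {Q₂ : R[X]}
    (hQ₂ : 2 ≤ Q₂.natDegree) : (length2Poly p₁ p₂ Q₁ Q₂).totalDegree =
      Q₂.natDegree * (length1Poly p₁ Q₁).totalDegree := by
  have hf := one_le_totalDegree_length1Poly hp₁ Q₁
  have hlt : (MvPolynomial.C p₂ * 𝐲 : MvPolynomial (Fin 2) R).totalDegree <
      (aeval (length1Poly p₁ Q₁) Q₂).totalDegree := by
    have hy := totalDegree_C_mul_le p₂ (𝐲 : MvPolynomial (Fin 2) R)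
    rw [MvPolynomial.totalDegree_X] at hy
    rw [totalDegree_aeval hf]
    nlinarith
  rw [length2Poly_eq_aeval, MvPolynomial.totalDegree_add_eq_right_of_totalDegree_lt hlt,
    totalDegree_aeval hf]

end Degree

/-! ### Affine and triangular automorphisms -/

section Affine

variable {R : Type*} [CommRing R]

lemma length1Poly_linear (a b c : R) : length1Poly a (C b * X + C c) =
    MvPolynomial.C a * 𝐱 + MvPolynomial.C b * 𝐲 + MvPolynomial.C c := by
  simp [length1Poly, MvPolynomial.algebraMap_eq, add_assoc]

lemma totalDegree_length1Poly_linear_le [Nontrivial R] (a b c : R) :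
    (length1Poly a (C b * X + C c)).totalDegree ≤ 1 :=
  (totalDegree_length1Poly_le _ _).trans (max_le le_rfl natDegree_linear_le)

lemma exists_eq_length1Poly_linear {P : MvPolynomial (Fin 2) R} (h : P.totalDegree ≤ 1) :
    ∃ a b c, P = length1Poly a (C b * X + C c) := by
  simp only [length1Poly_linear]
  rw [← MvPolynomial.support_sum_monomial_coeff P]
  refine Finset.sum_induction _ (fun P => ∃ a b c : R, P =
    MvPolynomial.C a * 𝐱 + MvPolynomial.C b * 𝐲 + MvPolynomial.C c) ?_ ⟨0, 0, 0, by simp⟩ ?_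
  · rintro _ _ ⟨a, b, c, rfl⟩ ⟨a', b', c', rfl⟩
    exact ⟨a + a', b + b', c + c', by simp only [map_add]; ring⟩
  · intro m hm
    have hdeg := (MvPolynomial.le_totalDegree hm).trans h
    rw [Finsupp.sum_fintype _ _ (fun _ => rfl), Fin.sum_univ_two] at hdeg
    obtain ⟨i, j, rfl⟩ : ∃ i j, m = Finsupp.single 0 i + Finsupp.single 1 j :=
      ⟨m 0, m 1, by ext k; fin_cases k <;> simp⟩
    generalize P.coeff _ = r
    obtain ⟨rfl, rfl⟩ | ⟨rfl, rfl⟩ | ⟨rfl, rfl⟩ :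
        (i = 0 ∧ j = 0) ∨ (i = 1 ∧ j = 0) ∨ (i = 0 ∧ j = 1) := by
      simp only [Finsupp.add_apply, Finsupp.single_apply] at hdeg
      grind
    · exact ⟨0, 0, r, by simp⟩
    · exact ⟨r, 0, 0, by simp [MvPolynomial.C_mul_X_eq_monomial]⟩
    · exact ⟨0, r, 0, by simp [MvPolynomial.C_mul_X_eq_monomial]⟩

lemma totalDegree_GA_apply_le {σ : GA 2 R} {P : MvPolynomial (Fin 2) R} (hP : P.totalDegree ≤ 1)
    {d : ℕ} (hx : (σ 𝐱).totalDegree ≤ d) (hy : (σ 𝐲).totalDegree ≤ d) :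
    (σ P).totalDegree ≤ d := by
  obtain ⟨a, b, c, rfl⟩ := exists_eq_length1Poly_linear hP
  rw [length1Poly_linear, map_add, map_add, map_mul, map_mul, GA_apply_C, GA_apply_C, GA_apply_C]
  refine (MvPolynomial.totalDegree_add _ _).trans (max_le ?_ (by simp))
  exact (MvPolynomial.totalDegree_add _ _).trans
    (max_le ((totalDegree_C_mul_le _ _).trans hx) ((totalDegree_C_mul_le _ _).trans hy))

lemma jacobian_length1Poly_linear (a b c a' b' c' : R) :
    jacobian (length1Poly a (C b * X + C c)) (length1Poly a' (C b' * X + C c')) =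
      MvPolynomial.C (a * b' - b * a') := by
  simp [jacobian, length1Poly_linear]

lemma constantCoeff_jacobian_length1Poly_linear (P : MvPolynomial (Fin 2) R) (a b c : R) :
    MvPolynomial.constantCoeff (jacobian P (length1Poly a (C b * X + C c))) =
      MvPolynomial.constantCoeff (MvPolynomial.pderiv 0 P) * b -
        MvPolynomial.constantCoeff (MvPolynomial.pderiv 1 P) * a := by
  simp [jacobian, length1Poly_linear]

/-- The linear automorphism `x_i ↦ ∑ j, M i j x_j`. -/
def linearGA {n : ℕ} (M : GL (Fin n) R) : GA n R :=
  mkGA M.1.toMvPolynomial M⁻¹.1.toMvPolynomial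
    (fun i => by
      rw [MvPolynomial.aeval_eq_bind₁, ← Matrix.toMvPolynomial_mul, Units.inv_mul,
        Matrix.toMvPolynomial_one])
    (fun i => by
      rw [MvPolynomial.aeval_eq_bind₁, ← Matrix.toMvPolynomial_mul, Units.mul_inv,
        Matrix.toMvPolynomial_one])

lemma linearGA_X {n : ℕ} (M : GL (Fin n) R) (i : Fin n) :
    linearGA M (MvPolynomial.X i) = M.1.toMvPolynomial i :=
  mkGA_X _ _ _ _ i

lemma linearGA_apply_X {n : ℕ} (M : GL (Fin n) R) (i : Fin n) :
    linearGA M (MvPolynomial.X i) = ∑ j, MvPolynomial.C (M i j) * MvPolynomial.X j := by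
  simp [linearGA_X, Matrix.toMvPolynomial, MvPolynomial.C_mul_X_eq_monomial]

lemma tri_mul_scaleY_mem_BA (u v : Rˣ) (g : R[X]) (w : R) : tri u g * scaleY v w ∈ BA 2 R := by
  refine Fin.forall_fin_two.2 ⟨⟨u, aeval 𝐲 g, ?_, by simp [length1Poly]⟩,
    ⟨v, MvPolynomial.C w, Subalgebra.algebraMap_mem _ w, by simp⟩⟩
  have hy : (𝐲 : MvPolynomial (Fin 2) R) ∈ MvPolynomial.supported R {j : Fin 2 | 0 < j} :=
    Algebra.subset_adjoin ⟨1, by simp, rfl⟩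
  exact Algebra.adjoin_le (Set.singleton_subset_iff.2 hy) (aeval_mem_adjoin_singleton R _)

variable [IsDomain R]

lemma mem_Aff_iff {n : ℕ} {σ : GA n R} :
    σ ∈ Aff n R ↔ ∀ i, (σ (MvPolynomial.X i)).totalDegree ≤ 1 :=
  forall_congr' fun i => ⟨le_of_eq, fun h => h.antisymm (one_le_totalDegree_GA σ i)⟩

lemma one_mem_Aff {n : ℕ} : (1 : GA n R) ∈ Aff n R :=
  fun i => MvPolynomial.totalDegree_X i

lemma mul_mem_Aff {σ τ : GA 2 R} (hσ : σ ∈ Aff 2 R) (hτ : τ ∈ Aff 2 R) : σ * τ ∈ Aff 2 R :=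
  mem_Aff_iff.2 fun i => totalDegree_GA_apply_le (hτ i).le (hσ 0).le (hσ 1).le

lemma linearGA_mem_Aff {n : ℕ} (M : GL (Fin n) R) : linearGA M ∈ Aff n R :=
  mem_Aff_iff.2 fun i => linearGA_X M i ▸ Matrix.toMvPolynomial_totalDegree_le _ i

lemma scaleY_mem_Aff (u : Rˣ) (w : R) : scaleY u w ∈ Aff 2 R := by
  refine mem_Aff_iff.2 (Fin.forall_fin_two.2 ⟨?_, ?_⟩)
  · rw [scaleY_x, MvPolynomial.totalDegree_X]
  · simpa [length1Poly_linear] using totalDegree_length1Poly_linear_le 0 (u : R) w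

lemma inv_mem_Aff {σ : GA 2 R} (hσ : σ ∈ Aff 2 R) : σ⁻¹ ∈ Aff 2 R := by
  obtain ⟨a, b, c, hx⟩ := exists_eq_length1Poly_linear (hσ 0).le
  obtain ⟨a', b', c', hy⟩ := exists_eq_length1Poly_linear (hσ 1).le
  obtain ⟨u, hu⟩ := exists_jacobian_eq_C σ
  rw [hx, hy, jacobian_length1Poly_linear] at hu
  have hdet := C_unit_mul_C_inv (n := 2) u
  rw [← hu, map_sub, map_mul, map_mul] at hdet
  rw [length1Poly_linear] at hx hy
  refine mem_Aff_iff.2 (Fin.forall_fin_two.2 ⟨?_, ?_⟩)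
  · have hinv : σ⁻¹ 𝐱 = length1Poly (↑u⁻¹ * b') (C (-(↑u⁻¹ * b)) * X +
        C (↑u⁻¹ * (b * c' - b' * c))) := by
      apply σ.injective
      rw [GA_apply_inv_self, length1Poly_linear]
      simp only [map_add, map_mul, map_neg, map_sub, GA_apply_C, hx, hy]
      linear_combination -𝐱 * hdet
    exact hinv ▸ totalDegree_length1Poly_linear_le _ _ _
  · have hinv : σ⁻¹ 𝐲 = length1Poly (-(↑u⁻¹ * a')) (C (↑u⁻¹ * a) * X +
        C (↑u⁻¹ * (a' * c - a * c'))) := by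
      apply σ.injective
      rw [GA_apply_inv_self, length1Poly_linear]
      simp only [map_add, map_mul, map_neg, map_sub, GA_apply_C, hx, hy]
      linear_combination -𝐲 * hdet
    exact hinv ▸ totalDegree_length1Poly_linear_le _ _ _

lemma exists_mem_Aff_of_totalDegree_le_one {F : MvPolynomial (Fin 2) R} (hF : F ∈ VA₂ R)
    (h : F.totalDegree ≤ 1) : ∃ a ∈ Aff 2 R, a 𝐲 = F := by
  obtain ⟨σ, rfl⟩ := hF
  obtain ⟨a, b, c, hy⟩ := exists_eq_length1Poly_linear h
  obtain ⟨u, hu⟩ := exists_jacobian_eq_C σ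
  rw [hy] at hu ⊢
  have hdet := congrArg MvPolynomial.constantCoeff hu
  rw [constantCoeff_jacobian_length1Poly_linear, MvPolynomial.constantCoeff_C] at hdet
  set M : Matrix (Fin 2) (Fin 2) R :=
    !![MvPolynomial.constantCoeff (MvPolynomial.pderiv 0 (σ 𝐱)),
      MvPolynomial.constantCoeff (MvPolynomial.pderiv 1 (σ 𝐱)); a, b]
  have hM : IsUnit M.det := by rw [Matrix.det_fin_two_of, hdet]; exact u.isUnit
  refine ⟨linearGA (.mk'' M hM) * scaleY 1 c, mul_mem_Aff (linearGA_mem_Aff _)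
    (scaleY_mem_Aff 1 c), ?_⟩
  simp [length1Poly_linear, linearGA_apply_X, M]

lemma exists_eq_tri_mul_scaleY {σ : GA 2 R} {b c : R}
    (h : σ 𝐲 = MvPolynomial.C b * 𝐲 + MvPolynomial.C c) :
    ∃ (u v : Rˣ) (g : R[X]), σ = tri u g * scaleY v c := by
  obtain ⟨v, rfl⟩ : IsUnit b := isUnit_of_C_mul_add_C_mem_VA₂ ⟨σ, h⟩
  obtain ⟨u, g, hg⟩ := exists_eq_tri_of_apply_y_eq (mul_scaleY_inv_y h)
  exact ⟨u, v, g, mul_inv_eq_iff_eq_mul.1 hg⟩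

lemma mem_BA_iff {σ : GA 2 R} :
    σ ∈ BA 2 R ↔ ∃ b c : R, σ 𝐲 = MvPolynomial.C b * 𝐲 + MvPolynomial.C c := by
  refine ⟨fun h => ?_, fun ⟨b, c, h⟩ => ?_⟩
  · obtain ⟨v, g, hg, hy⟩ := h 1
    have hempty : {j : Fin 2 | 1 < j} = ∅ := by
      ext j; fin_cases j <;> simp
    rw [hempty, MvPolynomial.supported_empty, Algebra.mem_bot] at hg
    obtain ⟨w, rfl⟩ := hg
    exact ⟨v, w, hy⟩
  · obtain ⟨u, v, g, rfl⟩ := exists_eq_tri_mul_scaleY h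
    exact tri_mul_scaleY_mem_BA u v g c

lemma exists_eq_tri_mul_scaleY_of_mem_BA {σ : GA 2 R} (h : σ ∈ BA 2 R) :
    ∃ (u v : Rˣ) (g : R[X]) (w : R), σ = tri u g * scaleY v w := by
  obtain ⟨b, c, h⟩ := mem_BA_iff.1 h
  obtain ⟨u, v, g, hσ⟩ := exists_eq_tri_mul_scaleY h
  exact ⟨u, v, g, c, hσ⟩

lemma mul_mem_BA {σ τ : GA 2 R} (hσ : σ ∈ BA 2 R) (hτ : τ ∈ BA 2 R) : σ * τ ∈ BA 2 R := by
  obtain ⟨b, c, hσ⟩ := mem_BA_iff.1 hσ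
  obtain ⟨b', c', hτ⟩ := mem_BA_iff.1 hτ
  refine mem_BA_iff.2 ⟨b' * b, b' * c + c', ?_⟩
  simp only [AlgEquiv.mul_apply, hτ, hσ, map_add, map_mul, GA_apply_C]
  ring

lemma inv_mem_BA {σ : GA 2 R} (hσ : σ ∈ BA 2 R) : σ⁻¹ ∈ BA 2 R := by
  obtain ⟨u, v, g, w, rfl⟩ := exists_eq_tri_mul_scaleY_of_mem_BA hσ
  refine mem_BA_iff.2 ⟨↑v⁻¹, -(↑v⁻¹ * w), ?_⟩
  have htri : (tri u g)⁻¹ 𝐲 = 𝐲 := (AlgEquiv.symm_apply_eq _).2 (tri_y u g).symm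
  rw [mul_inv_rev, AlgEquiv.mul_apply, htri, scaleY_inv_y, map_neg, map_mul]
  ring

lemma exists_apply_length1Poly_of_mem_BA {T : GA 2 R} (hT : T ∈ BA 2 R) :
    ∃ u : Rˣ, ∀ p Q, ∃ Q', T (length1Poly p Q) = length1Poly (p * u) Q' := by
  obtain ⟨u, v, g, w, rfl⟩ := exists_eq_tri_mul_scaleY_of_mem_BA hT
  refine ⟨u, fun p Q => ⟨C p * g + Q.comp (C (v : R) * X + C w), ?_⟩⟩
  simp only [length1Poly, map_add, map_mul, GA_apply_C, GA_aeval, AlgEquiv.mul_apply, scaleY_x,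
    scaleY_y, tri_x, tri_y, aeval_comp, aeval_C, aeval_X, MvPolynomial.algebraMap_eq]
  ring

end Affine

/-! ### Normal forms of tame automorphisms -/

section NormalForm

variable {R : Type*} [CommRing R]

/-- Products `a₀ t₁ a₁ ⋯ tₖ aₖ` of affine `aᵢ` and triangular `tᵢ` in which multiplication by
each `tᵢ` turns a pair of components with `deg σ(x) ≤ deg σ(y)` into one with
`deg σ(y) < deg σ(x)`. Over a domain every tame automorphism has this form. -/
inductive NormalForm : GA 2 R → Prop
  | aff {a : GA 2 R} (ha : a ∈ Aff 2 R) : NormalForm a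
  | step {ρ t a : GA 2 R} (hρ : NormalForm ρ)
      (hdeg : (ρ 𝐱).totalDegree ≤ (ρ 𝐲).totalDegree) (ht : t ∈ BA 2 R)
      (hlt : ((ρ * t) 𝐲).totalDegree < ((ρ * t) 𝐱).totalDegree) (ha : a ∈ Aff 2 R) :
      NormalForm (ρ * t * a)

lemma mem_TA_of_mem_Aff {n : ℕ} {σ : GA n R} (h : σ ∈ Aff n R) : σ ∈ TA n R :=
  Subgroup.subset_closure (Or.inl h)

lemma mem_TA_of_mem_BA {n : ℕ} {σ : GA n R} (h : σ ∈ BA n R) : σ ∈ TA n R :=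
  Subgroup.subset_closure (Or.inr h)

lemma NormalForm.mem_TA {ρ : GA 2 R} (h : NormalForm ρ) : ρ ∈ TA 2 R := by
  induction h with
  | aff ha => exact mem_TA_of_mem_Aff ha
  | step _ _ ht _ ha ih =>
    exact mul_mem (mul_mem ih (mem_TA_of_mem_BA ht)) (mem_TA_of_mem_Aff ha)

variable [IsDomain R]

lemma totalDegree_mul_apply_y_of_mem_BA (ρ : GA 2 R) {t : GA 2 R} (ht : t ∈ BA 2 R) :
    ((ρ * t) 𝐲).totalDegree = (ρ 𝐲).totalDegree := by
  obtain ⟨u, v, g, w, rfl⟩ := exists_eq_tri_mul_scaleY_of_mem_BA ht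
  simp only [AlgEquiv.mul_apply, scaleY_y, tri_y, map_add, map_mul, GA_apply_C]
  exact totalDegree_C_mul_add_C v.ne_zero (one_le_totalDegree_GA ρ 1) w

lemma tri_mem_Aff (u : Rˣ) {g : R[X]} (hg : g.natDegree ≤ 1) : tri u g ∈ Aff 2 R := by
  refine mem_Aff_iff.2 (Fin.forall_fin_two.2 ⟨?_, ?_⟩)
  · rw [tri_x]
    exact (totalDegree_length1Poly_le _ _).trans (max_le le_rfl hg)
  · rw [tri_y, MvPolynomial.totalDegree_X]

lemma totalDegree_mul_apply_y_lt_of_notMem_Aff {ρ t : GA 2 R}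
    (hdeg : (ρ 𝐱).totalDegree ≤ (ρ 𝐲).totalDegree) (ht : t ∈ BA 2 R) (hta : t ∉ Aff 2 R) :
    ((ρ * t) 𝐲).totalDegree < ((ρ * t) 𝐱).totalDegree := by
  rw [totalDegree_mul_apply_y_of_mem_BA ρ ht]
  obtain ⟨u, v, g, w, rfl⟩ := exists_eq_tri_mul_scaleY_of_mem_BA ht
  have hg : 2 ≤ g.natDegree := by
    by_contra! hg
    exact hta (mul_mem_Aff (tri_mem_Aff u (Nat.lt_succ_iff.1 hg)) (scaleY_mem_Aff v w))
  have hy := one_le_totalDegree_GA ρ 1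
  have hlt : (ρ 𝐲).totalDegree < (aeval (ρ 𝐲) g).totalDegree := by
    rw [totalDegree_aeval hy]
    nlinarith
  have hx : ((ρ * (tri u g * scaleY v w)) 𝐱) = MvPolynomial.C (u : R) * ρ 𝐱 + aeval (ρ 𝐲) g := by
    rw [← mul_tri_x, ← mul_assoc, AlgEquiv.mul_apply, scaleY_x]
  rwa [hx, MvPolynomial.totalDegree_add_eq_right_of_totalDegree_lt]
  rw [totalDegree_C_mul u.ne_zero]
  exact hdeg.trans_lt hlt

lemma exists_apply_y_eq_of_mem_Aff_of_notMem_BA {a : GA 2 R} (ha : a ∈ Aff 2 R)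
    (ha' : a ∉ BA 2 R) : ∃ m b c : R, m ≠ 0 ∧ a 𝐲 = length1Poly m (C b * X + C c) := by
  obtain ⟨m, b, c, h⟩ := exists_eq_length1Poly_linear (ha 1).le
  refine ⟨m, b, c, ?_, h⟩
  rintro rfl
  exact ha' (mem_BA_iff.2 ⟨b, c, by simpa [length1Poly_linear] using h⟩)

lemma apply_y_mem_B1_of_mem_Aff_of_notMem_BA {a : GA 2 R} (ha : a ∈ Aff 2 R) (ha' : a ∉ BA 2 R) :
    a 𝐲 ∈ B1 R := by
  obtain ⟨m, b, c, hm, h⟩ := exists_apply_y_eq_of_mem_Aff_of_notMem_BA ha ha'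
  exact h ▸ length1Poly_mem_B1 hm _

lemma totalDegree_mul_apply_y_of_notMem_BA {η a : GA 2 R}
    (hη : (η 𝐲).totalDegree < (η 𝐱).totalDegree) (ha : a ∈ Aff 2 R) (ha' : a ∉ BA 2 R) :
    ((η * a) 𝐲).totalDegree = (η 𝐱).totalDegree := by
  obtain ⟨m, b, c, hm, h⟩ := exists_apply_y_eq_of_mem_Aff_of_notMem_BA ha ha'
  have hlt : (MvPolynomial.C b * η 𝐲 + MvPolynomial.C c).totalDegree < (η 𝐱).totalDegree := by
    refine (MvPolynomial.totalDegree_add _ _).trans_lt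
      (max_lt ((totalDegree_C_mul_le _ _).trans_lt hη) ?_)
    rw [MvPolynomial.totalDegree_C]
    exact one_le_totalDegree_GA η 0
  have hηa : (η * a) 𝐲 =
      MvPolynomial.C m * η 𝐱 + (MvPolynomial.C b * η 𝐲 + MvPolynomial.C c) := by
    simp only [AlgEquiv.mul_apply, h, length1Poly_linear, map_add, map_mul, GA_apply_C, add_assoc]
  rw [hηa, MvPolynomial.totalDegree_add_eq_left_of_totalDegree_lt, totalDegree_C_mul hm]
  rwa [totalDegree_C_mul hm]

lemma NormalForm.mul_of_mem_Aff {ρ a : GA 2 R} (hρ : NormalForm ρ) (ha : a ∈ Aff 2 R) :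
    NormalForm (ρ * a) := by
  cases hρ with
  | aff h => exact .aff (mul_mem_Aff h ha)
  | step hρ hdeg ht hlt ha' =>
    rw [mul_assoc]
    exact .step hρ hdeg ht hlt (mul_mem_Aff ha' ha)

lemma NormalForm.mul_of_mem_BA_of_le {ρ t : GA 2 R} (hρ : NormalForm ρ)
    (hdeg : (ρ 𝐱).totalDegree ≤ (ρ 𝐲).totalDegree) (ht : t ∈ BA 2 R) : NormalForm (ρ * t) := by
  by_cases hta : t ∈ Aff 2 R
  · exact hρ.mul_of_mem_Aff hta
  · simpa only [mul_one] using NormalForm.step hρ hdeg ht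
      (totalDegree_mul_apply_y_lt_of_notMem_Aff hdeg ht hta) one_mem_Aff

lemma NormalForm.mul_of_mem_BA {ρ t : GA 2 R} (h : NormalForm ρ) (ht : t ∈ BA 2 R) :
    NormalForm (ρ * t) := by
  cases h with
  | aff ha => exact (NormalForm.aff ha).mul_of_mem_BA_of_le (by rw [ha 0, ha 1]) ht
  | @step ρ t' a hρ hdeg ht' hlt ha =>
    by_cases ha' : a ∈ BA 2 R
    · rw [mul_assoc ρ, mul_assoc ρ]
      exact hρ.mul_of_mem_BA_of_le hdeg (mul_mem_BA (mul_mem_BA ht' ha') ht)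
    · refine (NormalForm.step hρ hdeg ht' hlt ha).mul_of_mem_BA_of_le ?_ ht
      rw [totalDegree_mul_apply_y_of_notMem_BA hlt ha ha']
      exact totalDegree_GA_apply_le (ha 0).le le_rfl hlt.le

lemma normalForm_of_mem_TA {ρ : GA 2 R} (h : ρ ∈ TA 2 R) : NormalForm ρ := by
  induction h using Subgroup.closure_induction_right with
  | one => exact .aff one_mem_Aff
  | mul_right _ _ _ hy ih => exact hy.elim ih.mul_of_mem_Aff ih.mul_of_mem_BA
  | mul_inv_cancel _ _ _ hy ih =>
    exact hy.elim (fun h => ih.mul_of_mem_Aff (inv_mem_Aff h))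
      (fun h => ih.mul_of_mem_BA (inv_mem_BA h))

lemma NormalForm.exists_totalDegree_lt {ρ : GA 2 R} (h : NormalForm ρ)
    (hρ : 2 ≤ (ρ 𝐲).totalDegree) :
    ∃ η ∈ TA 2 R, ∃ a ∈ Aff 2 R \ BA 2 R, η (a 𝐲) = ρ 𝐲 ∧
      (η 𝐲).totalDegree < (ρ 𝐲).totalDegree := by
  induction h with
  | aff ha => rw [ha 1] at hρ; omega
  | @step ρ t a hnf _ ht hlt ha ih =>
    by_cases ha' : a ∈ BA 2 R
    · obtain ⟨u, v, g, w, hta⟩ := exists_eq_tri_mul_scaleY_of_mem_BA (mul_mem_BA ht ha')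
      rw [mul_assoc, totalDegree_mul_apply_y_of_mem_BA ρ (mul_mem_BA ht ha')] at hρ ⊢
      obtain ⟨η, hη, b, ⟨hb, hb'⟩, hηb, hηlt⟩ := ih hρ
      have hs : scaleY v w ∈ BA 2 R := mem_BA_iff.2 ⟨v, w, scaleY_y v w⟩
      refine ⟨η, hη, b * scaleY v w, ⟨mul_mem_Aff hb (scaleY_mem_Aff v w), fun hbs => hb' ?_⟩,
        ?_, hηlt⟩
      · simpa only [mul_inv_cancel_right] using mul_mem_BA hbs (inv_mem_BA hs)
      · simp only [hta, AlgEquiv.mul_apply, scaleY_y, tri_y, map_add, map_mul, GA_apply_C, hηb]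
    · refine ⟨ρ * t, mul_mem hnf.mem_TA (mem_TA_of_mem_BA ht), a, ⟨ha, ha'⟩, rfl, ?_⟩
      rwa [totalDegree_mul_apply_y_of_notMem_BA hlt ha ha']

end NormalForm

/-! ### Tame coordinates -/

section Tame

variable {R K : Type*} [CommRing R] [Field K] {φ : R →+* K}

lemma exists_eq_C_mul_y_add_C_of_map (hφ : Function.Injective φ) {P : MvPolynomial (Fin 2) R}
    {c s : K} (h : MvPolynomial.map φ P = MvPolynomial.C c * 𝐲 + MvPolynomial.C s) :
    ∃ b w : R, P = MvPolynomial.C b * 𝐲 + MvPolynomial.C w := by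
  have h' : MvPolynomial.map φ P = length1Poly 0 (C c * X + C s) := by
    rw [h, length1Poly_linear, map_zero, zero_mul, zero_add]
  obtain ⟨p, Q, rfl, hp, hQ⟩ := exists_eq_length1Poly_of_map hφ h'
  have hQ1 : Q.natDegree ≤ 1 := by
    rw [← natDegree_map_eq_of_injective hφ, hQ]
    exact natDegree_linear_le
  refine ⟨Q.coeff 1, Q.coeff 0, ?_⟩
  rw [(map_eq_zero_iff φ hφ).1 hp, eq_X_add_C_of_natDegree_le_one hQ1, length1Poly_linear]
  simp

variable {p₁ : R} {p₂ : K} {Q₁ : R[X]} {Q₂ : K[X]} {F : MvPolynomial (Fin 2) R}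

lemma totalDegree_length1Poly_lt (hφ : Function.Injective φ) (hp₁ : p₁ ≠ 0)
    (hQ₂ : 2 ≤ Q₂.natDegree)
    (hF : MvPolynomial.map φ F = length2Poly (φ p₁) p₂ (Q₁.map φ) Q₂) :
    (length1Poly p₁ Q₁).totalDegree < F.totalDegree := by
  have hf := one_le_totalDegree_length1Poly hp₁ Q₁
  rw [← totalDegree_map_of_injective hφ F, hF,
    totalDegree_length2Poly ((map_ne_zero_iff φ hφ).2 hp₁) p₂ _ hQ₂, ← map_length1Poly,
    totalDegree_map_of_injective hφ]
  nlinarith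

variable [IsDomain R]

lemma mem_TA_of_apply_x_eq {σ : GA 2 R} {a b : R} {P Q : R[X]} (ha : a ≠ 0)
    (hx : σ 𝐱 = length1Poly a P) (hy : σ 𝐲 = length1Poly b Q) : σ ∈ TA 2 R := by
  have hcancel : MvPolynomial.C a * σ 𝐲 - MvPolynomial.C b * σ 𝐱 =
      aeval 𝐲 (C a * Q - C b * P) := by
    rw [hx, hy]
    simp only [length1Poly, map_sub, map_mul, aeval_C, MvPolynomial.algebraMap_eq]
    ring
  have hpull : aeval (σ⁻¹ 𝐲) (C a * Q - C b * P) = length1Poly (-b) (C a * X) := by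
    rw [← GA_aeval, ← hcancel, map_sub, map_mul, map_mul, GA_apply_C, GA_apply_C,
      GA_inv_apply_self, GA_inv_apply_self]
    simp only [length1Poly, map_neg, map_mul, aeval_C, aeval_X, MvPolynomial.algebraMap_eq]
    ring
  have hdeg : (C a * Q - C b * P).natDegree * (σ⁻¹ 𝐲).totalDegree = 1 := by
    rw [← totalDegree_aeval (one_le_totalDegree_GA σ⁻¹ 1), hpull]
    have hX : (C a * X : R[X]).natDegree = 1 := natDegree_C_mul_X a ha
    exact le_antisymm ((totalDegree_length1Poly_le _ _).trans (max_le le_rfl hX.le))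
      (hX.ge.trans (natDegree_le_totalDegree_length1Poly _ _))
  obtain ⟨l, hl, hly⟩ := exists_mem_Aff_of_totalDegree_le_one ⟨σ⁻¹, rfl⟩
    (Nat.eq_one_of_mul_eq_one_left hdeg).le
  have hσl : σ * l ∈ BA 2 R := mem_BA_iff.2 ⟨1, 0, by simp [hly]⟩
  rw [← mul_inv_cancel_right σ l]
  exact mul_mem (mem_TA_of_mem_BA hσl) (inv_mem (mem_TA_of_mem_Aff hl))

lemma mem_TA_of_mem_B1 {σ : GA 2 R} (hx : σ 𝐱 ∈ B1 R) (hy : σ 𝐲 ∈ B1 R) : σ ∈ TA 2 R := by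
  obtain ⟨a, P, ha, hx⟩ := mem_B1_iff.1 hx
  obtain ⟨b, Q, -, hy⟩ := mem_B1_iff.1 hy
  exact mem_TA_of_apply_x_eq ha hx hy

lemma exists_map_apply_y_eq_C_mul_add_C (hφ : Function.Injective φ) {η : GA 2 R}
    {P : MvPolynomial (Fin 2) R} (hP : P ∈ B1 R) (hη : (η 𝐲).totalDegree < (η P).totalDegree)
    {Ψ : GA 2 K} (hΨ : Ψ 𝐲 = MvPolynomial.map φ (η P))
    (hΨη : (Ψ 𝐱).totalDegree < (η P).totalDegree) :
    ∃ c s : K, MvPolynomial.map φ (η 𝐲) = MvPolynomial.C c * Ψ 𝐱 + MvPolynomial.C s := by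
  obtain ⟨m, B, hm, rfl⟩ := mem_B1_iff.1 hP
  obtain ⟨u, k, hk⟩ := exists_map_apply_y_eq hφ hm hΨ
  rw [← totalDegree_map_of_injective hφ (η (length1Poly m B)), ← hΨ] at hη hΨη
  have hlt : (aeval (Ψ 𝐲) k).totalDegree < (Ψ 𝐲).totalDegree := by
    rw [← sub_eq_iff_eq_add'.2 hk]
    refine (MvPolynomial.totalDegree_sub _ _).trans_lt (max_lt ?_ ?_)
    · rwa [totalDegree_map_of_injective hφ]
    · exact (totalDegree_C_mul_le _ _).trans_lt hΨη
  rw [totalDegree_aeval (one_le_totalDegree_GA Ψ 1)] at hlt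
  have hk0 : k.natDegree = 0 := by
    by_contra! h
    exact hlt.not_ge (Nat.le_mul_of_pos_left _ (Nat.pos_of_ne_zero h))
  rw [eq_C_of_natDegree_eq_zero hk0, aeval_C] at hk
  exact ⟨u, k.coeff 0, hk⟩

lemma exists_mem_BA_mem_Aff_apply_y_eq {ρ : GA 2 R} (hρ : ρ ∈ TA 2 R) (hy : ρ 𝐲 ∈ B1 R) :
    ∃ t ∈ BA 2 R, ∃ a ∈ Aff 2 R, t (a 𝐲) = ρ 𝐲 := by
  rcases le_or_gt (ρ 𝐲).totalDegree 1 with hdeg | hdeg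
  · obtain ⟨a, ha, hay⟩ := exists_mem_Aff_of_totalDegree_le_one ⟨ρ, rfl⟩ hdeg
    exact ⟨1, mem_BA_iff.2 ⟨1, 0, by simp⟩, a, ha, hay⟩
  obtain ⟨η, -, a, ⟨ha, ha'⟩, hηa, hlt⟩ := (normalForm_of_mem_TA hρ).exists_totalDegree_lt hdeg
  obtain ⟨p, Q, hp, hpQ⟩ := mem_B1_iff.1 hy
  set φ := algebraMap R (FractionRing R)
  have hφ : Function.Injective φ := IsFractionRing.injective R (FractionRing R)
  obtain ⟨d, s, hds⟩ := exists_map_apply_y_eq_C_mul_add_C hφ (η := η)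
    (Ψ := length1GA (Units.mk0 (φ p) ((map_ne_zero_iff φ hφ).2 hp)) (Q.map φ))
    (apply_y_mem_B1_of_mem_Aff_of_notMem_BA ha ha') (hηa ▸ hlt)
    (by rw [hηa, hpQ, length1GA_y, map_length1Poly, Units.val_mk0])
    (by rwa [hηa, length1GA_x, MvPolynomial.totalDegree_X])
  rw [length1GA_x] at hds
  exact ⟨η, mem_BA_iff.2 (exists_eq_C_mul_y_add_C_of_map hφ hds), a, ha, hηa⟩

lemma apply_mem_B1_of_mem_BA {t : GA 2 R} (ht : t ∈ BA 2 R) {P : MvPolynomial (Fin 2) R}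
    (hP : P ∈ B1 R) : t P ∈ B1 R := by
  obtain ⟨p, Q, hp, rfl⟩ := mem_B1_iff.1 hP
  obtain ⟨u, hu⟩ := exists_apply_length1Poly_of_mem_BA ht
  obtain ⟨Q', hQ'⟩ := hu p Q
  exact hQ' ▸ length1Poly_mem_B1 (mul_ne_zero hp u.ne_zero) Q'

lemma exists_mul_tri_apply_x_mem_B1 {t a : GA 2 R} (ht : t ∈ BA 2 R) (ha : a ∈ Aff 2 R)
    (hy : (t * a) 𝐲 ∈ B1 R) : ∃ g : R[X], (t * a * tri 1 g) 𝐱 ∈ B1 R := by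
  obtain ⟨α, b, c, hax⟩ := exists_eq_length1Poly_linear (ha 0).le
  obtain ⟨u, hu⟩ := exists_apply_length1Poly_of_mem_BA ht
  obtain ⟨P, hP⟩ := hu α (C b * X + C c)
  have hx : (t * a) 𝐱 = length1Poly (α * u) P := by rw [AlgEquiv.mul_apply, hax, hP]
  by_cases hα : α = 0
  · obtain ⟨β, Q, hβ, hβQ⟩ := mem_B1_iff.1 hy
    refine ⟨X, mem_B1_iff.2 ⟨β, P + Q, hβ, ?_⟩⟩
    rw [mul_tri_x, hx, hβQ, hα]
    simp only [length1Poly, Units.val_one, map_one, one_mul, zero_mul, map_zero, aeval_X, map_add]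
    ring
  · refine ⟨0, mem_B1_iff.2 ⟨α * u, P, mul_ne_zero hα u.ne_zero, ?_⟩⟩
    rw [mul_tri_x, hx, Units.val_one, map_one, one_mul, map_zero, add_zero]

lemma exists_apply_x_mem_B1_of_isTame {P : MvPolynomial (Fin 2) R} (h : IsTame P)
    (hP : P ∈ B1 R) : ∃ σ : GA 2 R, σ 𝐱 ∈ B1 R ∧ σ 𝐲 = P := by
  obtain ⟨ρ, hρ, rfl⟩ := h
  obtain ⟨t, ht, a, ha, hta⟩ := exists_mem_BA_mem_Aff_apply_y_eq hρ hP
  obtain ⟨g, hg⟩ := exists_mul_tri_apply_x_mem_B1 ht ha (by rwa [AlgEquiv.mul_apply, hta])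
  exact ⟨t * a * tri 1 g, hg, by rw [mul_tri_y, AlgEquiv.mul_apply, hta]⟩

lemma exists_mem_TA_apply_y_eq [DecompositionMonoid R[X]] (hφ : Function.Injective φ)
    (hp₁ : p₁ ≠ 0) (hp₂ : p₂ ≠ 0) (hQ₁ : Q₁.eval 0 = 0) (hpQ : IsRelPrime (C p₁) Q₁)
    (hQ₂ : 2 ≤ Q₂.natDegree)
    (hF : MvPolynomial.map φ F = length2Poly (φ p₁) p₂ (Q₁.map φ) Q₂) (h : IsTame F) :
    ∃ η ∈ TA 2 R, ∃ a ∈ Aff 2 R \ BA 2 R, η (a 𝐲) = F ∧ ∃ (u : Rˣ) (w : R),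
      η 𝐲 = MvPolynomial.C (u : R) * length1Poly p₁ Q₁ + MvPolynomial.C w := by
  obtain ⟨ρ, hρ, rfl⟩ := h
  have hf := one_le_totalDegree_length1Poly hp₁ Q₁
  have hfF := totalDegree_length1Poly_lt hφ hp₁ hQ₂ hF
  obtain ⟨η, hη, a, ha, hηa, hlt⟩ :=
    (normalForm_of_mem_TA hρ).exists_totalDegree_lt (hf.trans_lt hfF)
  obtain ⟨Ψ, hΨx, hΨy⟩ := exists_length2GA hφ hp₁ hp₂ hF
  rw [← hηa] at hlt hfF hΨy
  obtain ⟨d, s, hds⟩ := exists_map_apply_y_eq_C_mul_add_C hφ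
    (apply_y_mem_B1_of_mem_Aff_of_notMem_BA ha.1 ha.2) hlt hΨy
    (by rwa [hΨx, totalDegree_map_of_injective hφ])
  rw [hΨx] at hds
  exact ⟨η, hη, a, ha, hηa, exists_unit_of_map_eq_C_mul_add_C hφ hp₁ hQ₁ hpQ ⟨η, rfl⟩ hds⟩

lemma exists_mem_B1_of_isTame [DecompositionMonoid R[X]] (hφ : Function.Injective φ)
    (hp₁ : p₁ ≠ 0) (hp₂ : p₂ ≠ 0) (hQ₁ : Q₁.eval 0 = 0) (hpQ : IsRelPrime (C p₁) Q₁)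
    (hQ₂ : 2 ≤ Q₂.natDegree)
    (hF : MvPolynomial.map φ F = length2Poly (φ p₁) p₂ (Q₁.map φ) Q₂) (h : IsTame F) :
    ∃ σ τ : GA 2 R, σ 𝐱 ∈ B1 R ∧ σ 𝐲 ∈ B1 R ∧ τ 𝐱 ∈ B1 R ∧ τ 𝐲 ∈ B1 R ∧ (σ * τ) 𝐲 = F := by
  obtain ⟨η, hη, a, ⟨ha, ha'⟩, hηa, u, w, hηy⟩ :=
    exists_mem_TA_apply_y_eq hφ hp₁ hp₂ hQ₁ hpQ hQ₂ hF h
  have hfB1 := length1Poly_mem_B1 hp₁ Q₁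
  have hf : IsTame (length1Poly p₁ Q₁) := ⟨η * (scaleY u w)⁻¹,
    mul_mem hη (inv_mem (mem_TA_of_mem_Aff (scaleY_mem_Aff u w))), mul_scaleY_inv_y hηy⟩
  obtain ⟨σ, hσx, hσy⟩ := exists_apply_x_mem_B1_of_isTame hf hfB1
  have hση : σ⁻¹ * η ∈ BA 2 R := mem_BA_iff.2 ⟨u, w, by
    rw [AlgEquiv.mul_apply, hηy, ← hσy, map_add, map_mul, GA_apply_C, GA_apply_C,
      GA_inv_apply_self]⟩
  have hτy : (σ⁻¹ * η * a) 𝐲 ∈ B1 R :=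
    apply_mem_B1_of_mem_BA hση (apply_y_mem_B1_of_mem_Aff_of_notMem_BA ha ha')
  obtain ⟨g, hτx⟩ := exists_mul_tri_apply_x_mem_B1 hση ha hτy
  refine ⟨σ, σ⁻¹ * η * a * tri 1 g, hσx, hσy ▸ hfB1, hτx, by rwa [mul_tri_y], ?_⟩
  rw [AlgEquiv.mul_apply, mul_tri_y, AlgEquiv.mul_apply, AlgEquiv.mul_apply, GA_apply_inv_self, hηa]

end Tame

end LengthTwo

end

theorem theoremP5_general {R K : Type*} [CommRing R] [IsDomain R] [DecompositionMonoid R[X]]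
    [Field K] {φ : R →+* K} (hφ : Function.Injective φ) {p₁ : R} {p₂ : K} {Q₁ : R[X]} {Q₂ : K[X]}
    (hp₁ : p₁ ≠ 0) (hp₂ : p₂ ≠ 0) (hQ₁ : Q₁.eval 0 = 0) (hpQ : IsRelPrime (C p₁) Q₁)
    (hQ₂ : 2 ≤ Q₂.natDegree) {F : MvPolynomial (Fin 2) R}
    (hF : MvPolynomial.map φ F = length2Poly (φ p₁) p₂ (Q₁.map φ) Q₂) (hcoord : F ∈ VA₂ R) :
    (IsTame F ↔ ∃ σ τ : GA 2 R,
      σ (MvPolynomial.X 0) ∈ B1 R ∧ σ (MvPolynomial.X 1) ∈ B1 R ∧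
      τ (MvPolynomial.X 0) ∈ B1 R ∧ τ (MvPolynomial.X 1) ∈ B1 R ∧
      (σ * τ) (MvPolynomial.X 1) = F) ∧
    (HasMateOfLengthOne F ↔ ∃ u : Rˣ, φ p₁ * p₂ = φ (u : R)) ∧
    (HasLengthOnePlusOne F ↔
      Q₁.map (Ideal.Quotient.mk (Ideal.span {p₁})) ∈ VA₁ (R ⧸ Ideal.span {p₁})) ∧
    (IsTame F ∨ HasMateOfLengthOne F → HasLengthOnePlusOne F) := by
  have tame_imp := exists_mem_B1_of_isTame hφ hp₁ hp₂ hQ₁ hpQ hQ₂ hF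
  refine ⟨⟨tame_imp, ?_⟩, ⟨exists_unit_of_hasMateOfLengthOne hφ hp₁ hp₂ hQ₁ hpQ hQ₂ hF, ?_⟩, ?_, ?_⟩
  · rintro ⟨σ, τ, hσx, hσy, hτx, hτy, h⟩
    exact ⟨σ * τ, mul_mem (mem_TA_of_mem_B1 hσx hσy) (mem_TA_of_mem_B1 hτx hτy), h⟩
  · rintro ⟨u, hu⟩
    exact hasMateOfLengthOne_of_unit hφ hp₁ hp₂ hF hcoord hu
  · rw [← length1Poly_mem_VA₂_iff (mem_nonZeroDivisors_of_ne_zero hp₁)]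
    exact ⟨length1Poly_mem_VA₂_of_hasLengthOnePlusOne hφ hp₁ hp₂ hQ₁ hpQ hQ₂ hF,
      hasLengthOnePlusOne_of_length1Poly_mem_VA₂ hφ hp₁ hp₂ hF hcoord⟩
  · rintro (h | h)
    · obtain ⟨σ, τ, -, hσy, -, hτy, hστ⟩ := tame_imp h
      exact ⟨σ, τ, hσy, hτy, hστ⟩
    · exact h.hasLengthOnePlusOne

theorem theoremP5 {R K : Type*} [CommRing R] [IsDomain R] [UniqueFactorizationMonoid R]
    [Field K] [Algebra R K] [IsFractionRing R K]
    (U : Set R) (hU : IsUnitRepresentatives U)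
    (p₁ : R) (p₂ : K) (Q₁ : R[X]) (Q₂ : K[X]) (hred : IsReducedL2 U p₁ p₂ Q₁ Q₂)
    (F : MvPolynomial (Fin 2) R)
    (hF : MvPolynomial.map (algebraMap R K) F =
      length2Poly (algebraMap R K p₁) p₂ (Q₁.map (algebraMap R K)) Q₂)
    (hcoord : F ∈ VA₂ R) :
    (IsTame F ↔ ∃ σ τ : GA 2 R,
      σ (MvPolynomial.X 0) ∈ B1 R ∧ σ (MvPolynomial.X 1) ∈ B1 R ∧
      τ (MvPolynomial.X 0) ∈ B1 R ∧ τ (MvPolynomial.X 1) ∈ B1 R ∧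
      (σ * τ) (MvPolynomial.X 1) = F) ∧
    (HasMateOfLengthOne F ↔ ∃ u : Rˣ, algebraMap R K p₁ * p₂ = algebraMap R K (u : R)) ∧
    (HasLengthOnePlusOne F ↔
      Q₁.map (Ideal.Quotient.mk (Ideal.span {p₁})) ∈ VA₁ (R ⧸ Ideal.span {p₁})) ∧
    (IsTame F ∨ HasMateOfLengthOne F → HasLengthOnePlusOne F) :=
  theoremP5_general (IsFractionRing.injective R K) (ne_zero_of_map hred.isL2.p₁_ne_zero)
    hred.isL2.p₂_ne_zero hred.Q₁_zero hred.gcd_eq_one hred.isL2.two_le_degree hF hcoord
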